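/- Conventions. We consider tuples $\mathbf A=(A_1,\dots,A_p)$ of endomorphisms of a finite-dimensional complex vector space $V$ (for instance $V=\mathbb C^n$, $A_j\in M(n,\mathbb C)$), up to simultaneous conjugacy $\sim$. The tuple is irreducible if $\{0\}$ and $V$ are the only subspaces invariant under all $A_j$. Define: * addition: $M_\mu(\mathbf A)=(A_1+\mu_1,\dots,A_p+\mu_p)$, $\mu\in\mathbb C^p$; * middle convolution $mc_\lambda(\mathbf A)$, $\lambda\in\mathbb C$: let $G_j\in\mathrm{End}(V^p)$ be the block matrix whose only nonzero block row is the $j$-th, equal to $(A_1,\dots,A_{j-1},A_j+\lambda,A_{j+1},\dots,A_p)$; let $\mathcal K=\{(u_1,\dots,u_p): A_ju_j=0\ \forall j\}$ and $\mathcal L_\lambda=\ker(G_1+\dots+G_p)$; then $mc_\lambda(\mathbf A)$ is the tuple induced by $(G_1,\dots,G_p)$ on $V^p/(\mathcal K+\mathcal L_\lambda)$; * $T_{(p,\infty)}(\mathbf A)=(A_1,\dots,A_{p-1},-(A_1+\dots+A_p))$, and $T_\sigma(\mathbf A)=(A_{\sigma(1)},\dots,A_{\sigma(p)})$ for a permutation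 $\sigma$ of $\{1,\dots,p\}$. A tuple is of Okubo normal form (ONF) if, up to $\sim$, there are a decomposition $V=V_1\oplus\dots\oplus V_p$ (zero blocks allowed) with projections $P_j$ onto $V_j$ and an $A\in\mathrm{End}(V)$ with $A_j=P_jA$ for all $j$. Put $n_j=\dim V_j$, let $A_{jj}\in\mathrm{End}(V_j)$ be the diagonal blocks of $A$, and consider the condition $$(*)\qquad \operatorname{rank}A=\dim V,\qquad \operatorname{rank}\bigl((A+\tau)P_i\bigr)=\operatorname{rank}\bigl(P_i(A+\tau)\bigr)=n_i\quad\text{for all } i \text{ and all } \tau\in\mathbb C .$$ Operations on systems of ONF: * extension $E^p_{\rho_1,\rho_2}$ ($\rho_1\rho_2\neq0$, defined under $(*)$): the ONF $(p+1)$-tuple on $V_1\oplus\dots\oplus V_p\oplus V_{p+1}$ with $V_{p+1}=\operatorname{Im}(A-\rho_1)(A-\rho_2)$, given by $\hat A=\begin{pmatrix}A&1\\-(A-\rho_1)(A-\rho_2)&-A+\rho_1+\rho_2\end{pmatrix}$; * generic Euler transformation $E_\epsilon$ (defined under $(*)$ if $-\epsilon$ is not an eigenvalue of $A$): $A\mapsto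 A+\epsilon$, same blocks; * restriction $R^{p+1}$ of an ONF $(p+1)$-tuple, defined if the tuple is irreducible, $A$ is not a scalar, $(A-\mu_1)(A-\mu_2)=0$ for some $\mu_1,\mu_2\in\mathbb C$, and $\mu_1+\mu_2$ is not an eigenvalue of $A_{p+1,p+1}$: the last block row and the last block column of $A$ are deleted, giving an ONF $p$-tuple. Moreover $R^{p+1}_j=R^{p+1}\circ T_{(j,p+1)}$, where $(j,p+1)$ is the transposition. Theorem (equivalence of algorithms). Let $\mathbf A\in M(n,\mathbb C)^p$ be irreducible and, if $n=1$, suppose that at least two of the $A_j$ are nonzero. Let $\mathbf B\in M(n',\mathbb C)^p$ be obtained (up to $\sim$) from $\mathbf A$ by finitely many additions, middle convolutions and operations $T_{(p,\infty)}$ and $T_\sigma$. Then: 1. $mc_\alpha(\mathbf A)$ and $mc_\beta(\mathbf B)$ are of ONF for all but finitely many $\alpha,\beta\in\mathbb C$; and if $\mathbf A$ is of ONF, then $\alpha=0$ is allowed: $mc_0(\mathbf A)\sim\mathbf A$ is of ONF. 2. For all $\alpha,\beta\in\mathbb C$ such that $mc_\alpha(\mathbf A)$ and $mc_\beta(\mathbf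 B)$ are of ONF and $mc_\beta(\mathbf B)$ has positive rank (is not the tuple on the zero space), $mc_\beta(\mathbf B)$ can be obtained, up to $\sim$, from $mc_\alpha(\mathbf A)$ by a finite (possibly empty) iteration of operations $R^{p+1}_j\circ E_\epsilon\circ E^p_{\rho_1,\rho_2}$ with suitable $j\in\{1,\dots,p\}$ and $\epsilon,\rho_1,\rho_2\in\mathbb C$, that is, by extensions, generic Euler transformations and restrictions. -/

import Mathlib

/-- A tuple `(A_1, …, A_p)` of endomorphisms of a finite dimensional complex vector space. -/
structure MatTuple (p : ℕ) where
  V : Type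
  [instAddCommGroup : AddCommGroup V]
  [instModule : Module ℂ V]
  [instFinite : FiniteDimensional ℂ V]
  op : Fin p → Module.End ℂ V

attribute [instance] MatTuple.instAddCommGroup MatTuple.instModule MatTuple.instFinite

namespace MatTuple

variable {p : ℕ}

/-- The tuple of endomorphisms of `ℂⁿ` given by a tuple of `n × n` matrices. -/
def ofMatrices {n : ℕ} (A : Fin p → Matrix (Fin n) (Fin n) ℂ) : MatTuple p where
  V := Fin n → ℂ
  op := fun j => Matrix.toLin' (A j)

/-- `A ∼ B`: simultaneous conjugacy. -/
def Similar (X Y : MatTuple p) : Prop :=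
  ∃ g : X.V ≃ₗ[ℂ] Y.V, ∀ (j : Fin p) (v : X.V), g (X.op j v) = Y.op j (g v)

/-- No common invariant subspaces besides `0` and the whole space. -/
def IsIrreducible (X : MatTuple p) : Prop :=
  ∀ W : Submodule ℂ X.V, (∀ j, ∀ v ∈ W, X.op j v ∈ W) → W = ⊥ ∨ W = ⊤

/-- The addition `M_μ(A) = (A_1 + μ_1, …, A_p + μ_p)`. -/
def addition (X : MatTuple p) (μ : Fin p → ℂ) : MatTuple p where
  V := X.V
  op := fun j => X.op j + μ j • (1 : Module.End ℂ X.V)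

/-- `T_σ(A) = (A_{σ(1)}, …, A_{σ(p)})`. -/
def perm (X : MatTuple p) (σ : Equiv.Perm (Fin p)) : MatTuple p where
  V := X.V
  op := fun j => X.op (σ j)

/-- `T_{(j,∞)}(A)`: the `j`-th entry is replaced by `-(A_1 + ⋯ + A_p)`. -/
def inftySwap (X : MatTuple p) (j : Fin p) : MatTuple p where
  V := X.V
  op := Function.update X.op j (-∑ i, X.op i)

/-! ### Middle convolution -/

/-- The convolution matrix `G_j` on `V^p`: its only nonzero block row is the `j`-th one, which is
`(A_1, …, A_j + c, …, A_p)`. -/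
def conv (X : MatTuple p) (c : ℂ) (j : Fin p) : Module.End ℂ (Fin p → X.V) :=
  LinearMap.single ℂ (fun _ : Fin p => X.V) j ∘ₗ
    ((∑ i, X.op i ∘ₗ LinearMap.proj i) + c • LinearMap.proj j)

/-- The subspace `𝓚 = {(u_1, …, u_p) ; A_j u_j = 0 for all j}`. -/
def convK (X : MatTuple p) : Submodule ℂ (Fin p → X.V) :=
  Submodule.pi Set.univ fun j => LinearMap.ker (X.op j)

/-- The subspace `𝓛_c = ker (G_1 + ⋯ + G_p)`. -/
def convL (X : MatTuple p) (c : ℂ) : Submodule ℂ (Fin p → X.V) :=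
  LinearMap.ker (∑ j, X.conv c j)

theorem conv_apply (X : MatTuple p) (c : ℂ) (j : Fin p) (u : Fin p → X.V) :
    X.conv c j u = Pi.single j ((∑ i, X.op i (u i)) + c • u j) := by
  simp [conv, LinearMap.sum_apply]

theorem conv_invariant (X : MatTuple p) (c : ℂ) (j : Fin p) :
    X.convK ⊔ X.convL c ≤ (X.convK ⊔ X.convL c).comap (X.conv c j) := by
  refine sup_le ?_ ?_
  · intro u hu
    refine Submodule.mem_sup_left ?_
    have hu' : ∀ i, X.op i (u i) = 0 := by simpa [convK] using hu
    simp only [convK, Submodule.mem_pi, Set.mem_univ, forall_const, LinearMap.mem_ker]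
    intro i
    rw [conv_apply]
    by_cases h : i = j
    · subst h
      simp [hu']
    · simp [h]
  · intro u hu
    have hu' : ∑ i, X.conv c i u = 0 := by
      simpa [convL, LinearMap.sum_apply] using hu
    have h : X.conv c j u = 0 := by
      have := congrFun hu' j
      simp only [conv_apply, Finset.sum_apply, Pi.single_apply, Finset.sum_ite_eq,
        Finset.mem_univ, if_true, Pi.zero_apply] at this
      rw [conv_apply, this, Pi.single_zero]
    simp [h]

/-- The middle convolution `mc_c(A)`: the tuple induced by `(G_1, …, G_p)` on
`V^p / (𝓚 + 𝓛_c)`. -/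
def mc (X : MatTuple p) (c : ℂ) : MatTuple p where
  V := (Fin p → X.V) ⧸ (X.convK ⊔ X.convL c)
  op := fun j => (X.convK ⊔ X.convL c).mapQ (X.convK ⊔ X.convL c) (X.conv c j)
    (X.conv_invariant c j)

/-- One addition, middle convolution, `T_{(p,∞)}` or `T_σ`; tuples are considered up to `∼`. -/
inductive KatzStep : MatTuple p → MatTuple p → Prop
  | addition (X : MatTuple p) (μ : Fin p → ℂ) : KatzStep X (X.addition μ)
  | mc (X : MatTuple p) (c : ℂ) : KatzStep X (X.mc c)
  | inftySwap (X : MatTuple p) (j : Fin p) (hj : (j : ℕ) + 1 = p) : KatzStep X (X.inftySwap j)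
  | perm (X : MatTuple p) (σ : Equiv.Perm (Fin p)) : KatzStep X (X.perm σ)
  | similar (X Y : MatTuple p) (h : X.Similar Y) : KatzStep X Y

/-- `Y` is obtained from `X` by finitely many additions, middle convolutions, `T_{(p,∞)}` and
`T_σ`. -/
def KatzReachable (X Y : MatTuple p) : Prop :=
  Relation.ReflTransGen KatzStep X Y

end MatTuple

/-! ### Systems of Okubo normal form -/

/-- The data of a system `(x - T) du/dx = A u` of Okubo normal form with
`T = t_1 P_1 + ⋯ + t_p P_p`: the block decomposition of the space, given by the projections `P_j`
onto the blocks (some blocks may be zero), and the matrix `A`.  The pairwise distinct points `t_j`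
play no role in the operations below. -/
structure OkuboSystem (p : ℕ) where
  V : Type
  [instAddCommGroup : AddCommGroup V]
  [instModule : Module ℂ V]
  [instFinite : FiniteDimensional ℂ V]
  P : Fin p → Module.End ℂ V
  isProj : CompleteOrthogonalIdempotents P
  A : Module.End ℂ V

attribute [instance] OkuboSystem.instAddCommGroup OkuboSystem.instModule OkuboSystem.instFinite

namespace OkuboSystem

variable {p : ℕ}

/-- The residue matrices `A_j`: the `j`-th block row is that of `A`, the other rows are zero. -/
def toTuple (S : OkuboSystem p) : MatTuple p where
  V := S.V
  op := fun j => S.P j * S.A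

/-- The diagonal block `A_{jj}`. -/
def diagBlock (S : OkuboSystem p) (j : Fin p) : Module.End ℂ (LinearMap.range (S.P j)) :=
  (S.P j).rangeRestrict ∘ₗ S.A ∘ₗ (LinearMap.range (S.P j)).subtype

/-- `rank A = n`, and `rank ((A + τ) P_i) = rank (P_i (A + τ)) = n_i` for all `i` and `τ`. -/
def RankCondition (S : OkuboSystem p) : Prop :=
  Module.finrank ℂ (LinearMap.range S.A) = Module.finrank ℂ S.V ∧
  ∀ (i : Fin p) (τ : ℂ),
    Module.finrank ℂ (LinearMap.range ((S.A + τ • (1 : Module.End ℂ S.V)) * S.P i)) =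
      Module.finrank ℂ (LinearMap.range (S.P i)) ∧
    Module.finrank ℂ (LinearMap.range (S.P i * (S.A + τ • (1 : Module.End ℂ S.V)))) =
      Module.finrank ℂ (LinearMap.range (S.P i))

/-- The transformation `A ↦ A + c`. -/
def euler (S : OkuboSystem p) (c : ℂ) : OkuboSystem p where
  V := S.V
  P := S.P
  isProj := S.isProj
  A := S.A + c • (1 : Module.End ℂ S.V)

/-! #### Extension -/

/-- `(A - ρ₁)(A - ρ₂)`. -/
def quad (S : OkuboSystem p) (ρ₁ ρ₂ : ℂ) : Module.End ℂ S.V :=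
  (S.A - ρ₁ • (1 : Module.End ℂ S.V)) * (S.A - ρ₂ • (1 : Module.End ℂ S.V))

theorem quad_comm (S : OkuboSystem p) (ρ₁ ρ₂ : ℂ) :
    S.A * S.quad ρ₁ ρ₂ = S.quad ρ₁ ρ₂ * S.A := by
  simp only [quad, mul_sub, sub_mul, mul_assoc, mul_smul_comm, smul_mul_assoc, mul_one, one_mul]

theorem quad_range (S : OkuboSystem p) (ρ₁ ρ₂ : ℂ) :
    ∀ v ∈ LinearMap.range (S.quad ρ₁ ρ₂), S.A v ∈ LinearMap.range (S.quad ρ₁ ρ₂) := by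
  rintro _ ⟨w, rfl⟩
  exact ⟨S.A w, (LinearMap.congr_fun (S.quad_comm ρ₁ ρ₂) w).symm⟩

/-- The projections of the extended system on `V × V'`: those of the old system, extended by zero,
and the projection onto the new block `V'`. -/
def extP {V V' : Type} [AddCommGroup V] [Module ℂ V] [AddCommGroup V'] [Module ℂ V']
    (P : Fin p → Module.End ℂ V) : Fin (p + 1) → Module.End ℂ (V × V') :=
  Fin.snoc (α := fun _ => Module.End ℂ (V × V')) (fun i => LinearMap.prodMap (P i) 0)
    (LinearMap.prodMap 0 1)

theorem extP_isProj {V V' : Type} [AddCommGroup V] [Module ℂ V] [AddCommGroup V'] [Module ℂ V']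
    (P : Fin p → Module.End ℂ V) (h : CompleteOrthogonalIdempotents P) :
    CompleteOrthogonalIdempotents (extP (V' := V') P) := by
  have hsum : ∀ v, ∑ i, P i v = v := fun v => by
    simpa [LinearMap.sum_apply] using LinearMap.congr_fun h.complete v
  refine ⟨⟨?_, ?_⟩, ?_⟩
  · intro i
    refine Fin.lastCases ?_ (fun i => ?_) i
    · ext v <;> simp [extP]
    · have := fun v => LinearMap.congr_fun (h.idem i) v
      refine LinearMap.ext fun v => Prod.ext ?_ ?_
      · simpa [extP] using this v.1
      · simp [extP]
  · intro i j
    refine Fin.lastCases ?_ (fun i => ?_) i <;> refine Fin.lastCases ?_ (fun j => ?_) j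
    · intro hij
      exact absurd rfl hij
    · intro _
      refine LinearMap.ext fun v => Prod.ext ?_ ?_ <;> simp [extP]
    · intro _
      refine LinearMap.ext fun v => Prod.ext ?_ ?_ <;> simp [extP]
    · intro hij
      have := fun v => LinearMap.congr_fun (h.ortho (i := i) (j := j) (fun e => hij (by rw [e]))) v
      refine LinearMap.ext fun v => Prod.ext ?_ ?_
      · simpa [extP] using this v.1
      · simp [extP]
  · refine LinearMap.ext fun v => Prod.ext ?_ ?_
    · simp [Fin.sum_univ_castSucc, extP, LinearMap.sum_apply, Prod.fst_sum, hsum]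
    · simp [Fin.sum_univ_castSucc, extP, LinearMap.sum_apply, Prod.snd_sum]

/-- The extension with respect to `ρ₁, ρ₂`: on `V ⊕ Im (A - ρ₁)(A - ρ₂)` the matrix
`(A, 1; -(A - ρ₁)(A - ρ₂), -A + ρ₁ + ρ₂)`, where the second summand is the block of a new
point `t_{p+1}`. -/
def extension (S : OkuboSystem p) (ρ₁ ρ₂ : ℂ) : OkuboSystem (p + 1) where
  V := S.V × LinearMap.range (S.quad ρ₁ ρ₂)
  P := extP S.P
  isProj := extP_isProj S.P S.isProj
  A := LinearMap.prod
    (S.A ∘ₗ LinearMap.fst ℂ _ _ +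
      (LinearMap.range (S.quad ρ₁ ρ₂)).subtype ∘ₗ LinearMap.snd ℂ _ _)
    (-((S.quad ρ₁ ρ₂).rangeRestrict ∘ₗ LinearMap.fst ℂ _ _) +
      (-(S.A.restrict (S.quad_range ρ₁ ρ₂)) + (ρ₁ + ρ₂) • LinearMap.id) ∘ₗ LinearMap.snd ℂ _ _)

/-! #### Restriction -/

/-- The projection `1 - P_{p+1}` onto the sum of the first `p` blocks. -/
def initProj (S : OkuboSystem (p + 1)) : S.V →ₗ[ℂ] LinearMap.ker (S.P (Fin.last p)) :=
  LinearMap.codRestrict _ (1 - S.P (Fin.last p)) (fun v => by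
    have := LinearMap.congr_fun (S.isProj.idem (Fin.last p)) v
    simp only [Module.End.mul_apply] at this
    simp [this])

theorem initProj_coe (S : OkuboSystem (p + 1)) (v : S.V) :
    (S.initProj v : S.V) = v - S.P (Fin.last p) v := by
  simp [initProj]

theorem P_mem_ker (S : OkuboSystem (p + 1)) (i : Fin p) :
    ∀ v ∈ LinearMap.ker (S.P (Fin.last p)), S.P i.castSucc v ∈ LinearMap.ker (S.P (Fin.last p)) := by
  intro v _
  have := LinearMap.congr_fun
    (S.isProj.ortho (i := Fin.last p) (j := i.castSucc) (Fin.castSucc_lt_last i).ne') v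
  simpa using this

/-- The restriction: the last block row and block column of `A` are deleted. -/
def restriction (S : OkuboSystem (p + 1)) : OkuboSystem p where
  V := LinearMap.ker (S.P (Fin.last p))
  P := fun i => (S.P i.castSucc).restrict (S.P_mem_ker i)
  isProj := by
    refine ⟨⟨?_, ?_⟩, ?_⟩
    · intro i
      refine LinearMap.ext fun v => Subtype.ext ?_
      simpa using LinearMap.congr_fun (S.isProj.idem i.castSucc) (v : S.V)
    · intro i j hij
      refine LinearMap.ext fun v => Subtype.ext ?_
      have h : i.castSucc ≠ j.castSucc := fun e => hij (Fin.castSucc_injective p e)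
      simpa using LinearMap.congr_fun (S.isProj.ortho h) (v : S.V)
    · refine LinearMap.ext fun v => Subtype.ext ?_
      have h := LinearMap.congr_fun S.isProj.complete (v : S.V)
      have hv : S.P (Fin.last p) (v : S.V) = 0 := v.2
      simpa [Fin.sum_univ_castSucc, LinearMap.sum_apply, hv] using h
  A := S.initProj ∘ₗ S.A ∘ₗ (LinearMap.ker (S.P (Fin.last p))).subtype

/-- The systems to which the restriction applies: linearly irreducible ones such that `A` has a
minimal polynomial `(x - μ₁)(x - μ₂)` of degree two (`μ₁ = μ₂` is allowed) and `μ₁ + μ₂` is not an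
eigenvalue of the last diagonal block. -/
def Restrictable (S : OkuboSystem (p + 1)) : Prop :=
  S.toTuple.IsIrreducible ∧
  ∃ μ₁ μ₂ : ℂ, S.quad μ₁ μ₂ = 0 ∧ (∀ c : ℂ, S.A ≠ c • (1 : Module.End ℂ S.V)) ∧
    ¬ (S.diagBlock (Fin.last p)).HasEigenvalue (μ₁ + μ₂)

end OkuboSystem

namespace MatTuple

variable {p : ℕ}

/-- The tuple is of Okubo normal form (up to `∼`). -/
def IsONF (X : MatTuple p) : Prop :=
  ∃ S : OkuboSystem p, X.Similar S.toTuple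

/-- `Y = E^p_{ρ₁,ρ₂}(X)`. -/
def IsExtension (ρ₁ ρ₂ : ℂ) (X : MatTuple p) (Y : MatTuple (p + 1)) : Prop :=
  ρ₁ ≠ 0 ∧ ρ₂ ≠ 0 ∧ ∃ S : OkuboSystem p, X.Similar S.toTuple ∧ S.RankCondition ∧
    (S.extension ρ₁ ρ₂).toTuple.Similar Y

/-- `Y = E_ε(X)` is a generic Euler transform of `X`. -/
def IsEuler (ε : ℂ) (X Y : MatTuple p) : Prop :=
  ∃ S : OkuboSystem p, X.Similar S.toTuple ∧ S.RankCondition ∧ ¬ S.A.HasEigenvalue (-ε) ∧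
    (S.euler ε).toTuple.Similar Y

/-- `Y = R^{p+1}(X)`. -/
def IsRestriction (X : MatTuple (p + 1)) (Y : MatTuple p) : Prop :=
  ∃ S : OkuboSystem (p + 1), X.Similar S.toTuple ∧ S.Restrictable ∧
    S.restriction.toTuple.Similar Y

/-- `Y = R^{p+1}_j(X)`, where `R^{p+1}_j = R^{p+1} ∘ T_{(j,p+1)}`. -/
def IsRestrictionAt (j : Fin p) (X : MatTuple (p + 1)) (Y : MatTuple p) : Prop :=
  IsRestriction (X.perm (Equiv.swap j.castSucc (Fin.last p))) Y

/-- `Y` is obtained from `X` by one operation `R^{p+1}_j ∘ E_ε ∘ E^p_{ρ₁,ρ₂}`. -/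
def YokoyamaStep (X Y : MatTuple p) : Prop :=
  ∃ (j : Fin p) (ε ρ₁ ρ₂ : ℂ) (X₁ X₂ : MatTuple (p + 1)),
    IsExtension ρ₁ ρ₂ X X₁ ∧ IsEuler ε X₁ X₂ ∧ IsRestrictionAt j X₂ Y

/-- `Y` is obtained, up to `∼`, from `X` by finitely many operations
`R^{p+1}_j ∘ E_ε ∘ E^p_{ρ₁,ρ₂}`. -/
def YokoyamaReachable (X Y : MatTuple p) : Prop :=
  ∃ Z : MatTuple p, Relation.ReflTransGen YokoyamaStep X Z ∧ Z.Similar Y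

end MatTuple

/-! Write `mc_c(X)` through the Okubo system `okubo X c` on `⊕ Im A_i ≅ V^p/𝓚`, whose matrix sends
`w` to `(A_i(∑ w_k) + c w_i)_i`. The convolution is the image of this matrix, and changing `c` is an
Euler transformation. For `ρ₁ = c`, `ρ₂ = c + ν` the extension is the Okubo system of `X` with the
further entry `ν - ∑ A_i` (`extension_okubo`), and restriction drops an entry (`restriction_okubo`).
Hence one operation `R_j ∘ E_ε ∘ E_{ρ₁,ρ₂}` carries `mc_c(X)` to `mc_d(T X)`, where `T` replaces
`A_j` by `ν - ∑ A_i` (`Admissible.yokoyamaStep`).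

These replacements generate all additions, permutations and `T_{(p,∞)}`, while `mc_b` only shifts
the parameter. So the property "`mc_c(X)` is reachable for all but finitely many `c`" propagates
along Katz operations. Passing between generic parameters and a prescribed Okubo system costs two
replacements that cancel each other (`Admissible.genericallyReachable_self`,
`GenericallyReachable.reachable`).

The argument needs kernel and range conditions (`Admissible`), which are automatic for irreducible
tuples in dimension at least two and fail in dimension one when at most one entry is nonzero. The
invariant `Controlled` therefore records, in dimension one, a statement about all admissible
one-dimensional tuples; the remaining case is settled by `reachable_scalar_single`. -/

open Module

/-! ### Simultaneous conjugacy and its compatibility with middle convolution. -/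

namespace MatTuple

variable {p : ℕ}

theorem Similar.of_bijective {X Y : MatTuple p} (f : X.V →ₗ[ℂ] Y.V) (hf : Function.Bijective f)
    (h : ∀ j v, f (X.op j v) = Y.op j (f v)) : X.Similar Y :=
  ⟨LinearEquiv.ofBijective f hf, h⟩

theorem Similar.refl (X : MatTuple p) : X.Similar X :=
  ⟨LinearEquiv.refl ℂ X.V, fun _ _ => rfl⟩

theorem Similar.symm {X Y : MatTuple p} : X.Similar Y → Y.Similar X := by
  rintro ⟨g, hg⟩
  refine ⟨g.symm, fun j v => g.injective ?_⟩
  rw [hg, g.apply_symm_apply, g.apply_symm_apply]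

theorem Similar.trans {X Y Z : MatTuple p} : X.Similar Y → Y.Similar Z → X.Similar Z := by
  rintro ⟨g, hg⟩ ⟨h, hh⟩
  exact ⟨g.trans h, fun j v => by simp [hg, hh]⟩

theorem Similar.finrank_eq {X Y : MatTuple p} : X.Similar Y → finrank ℂ X.V = finrank ℂ Y.V :=
  fun ⟨g, _⟩ => g.finrank_eq

theorem Similar.isONF {X Y : MatTuple p} (h : X.Similar Y) : X.IsONF → Y.IsONF :=
  fun ⟨S, hS⟩ => ⟨S, h.symm.trans hS⟩

theorem Similar.perm {X Y : MatTuple p} (h : X.Similar Y) (σ : Equiv.Perm (Fin p)) :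
    (X.perm σ).Similar (Y.perm σ) := by
  obtain ⟨g, hg⟩ := h
  exact ⟨g, fun j v => hg (σ j) v⟩

theorem mem_convK {X : MatTuple p} {u : Fin p → X.V} : u ∈ X.convK ↔ ∀ j, X.op j (u j) = 0 := by
  simp [convK]

theorem mem_convL {X : MatTuple p} {c : ℂ} {u : Fin p → X.V} :
    u ∈ X.convL c ↔ ∀ j, (∑ i, X.op i (u i)) + c • u j = 0 := by
  rw [convL, LinearMap.mem_ker, LinearMap.sum_apply, funext_iff]
  simp only [conv_apply, Finset.sum_apply, Pi.single_apply, Finset.sum_ite_eq, Finset.mem_univ,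
    if_true, Pi.zero_apply]

/-- A quotient of `V^p` by `𝓚 + 𝓛_c` with its induced operators is the middle convolution. -/
theorem mc_similar_of_surjective (X Z : MatTuple p) (c : ℂ) (f : (Fin p → X.V) →ₗ[ℂ] Z.V)
    (hf : Function.Surjective f) (hker : ∀ u, f u = 0 ↔ u ∈ X.convK ⊔ X.convL c)
    (h : ∀ j u, f (X.conv c j u) = Z.op j (f u)) : (X.mc c).Similar Z := by
  have hk : X.convK ⊔ X.convL c = LinearMap.ker f := by
    ext u; rw [LinearMap.mem_ker, hker]
  refine ⟨(Submodule.quotEquivOfEq _ _ hk).trans (f.quotKerEquivOfSurjective hf), fun j v => ?_⟩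
  obtain ⟨u, rfl⟩ := Submodule.mkQ_surjective _ v
  exact h j u

theorem Similar.mc {X Y : MatTuple p} (h : X.Similar Y) (c : ℂ) : (X.mc c).Similar (Y.mc c) := by
  obtain ⟨g, hg⟩ := h
  let e : (Fin p → X.V) ≃ₗ[ℂ] (Fin p → Y.V) := LinearEquiv.piCongrRight fun _ => g
  have he : ∀ u i, e u i = g (u i) := fun u i => rfl
  have hK : ∀ u, e u ∈ Y.convK ↔ u ∈ X.convK := fun u => by
    simp [mem_convK, he, ← hg]
  have hL : ∀ u, e u ∈ Y.convL c ↔ u ∈ X.convL c := fun u => by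
    simp only [mem_convL, he, ← hg, ← map_sum, ← map_smul, ← map_add, map_eq_zero_iff g g.injective]
  have hmap : (X.convK ⊔ X.convL c).map (e : (Fin p → X.V) →ₗ[ℂ] (Fin p → Y.V)) =
      Y.convK ⊔ Y.convL c := by
    rw [Submodule.map_sup]
    congr 1
    · ext u
      rw [Submodule.mem_map_equiv, ← hK, e.apply_symm_apply]
    · ext u
      rw [Submodule.mem_map_equiv, ← hL, e.apply_symm_apply]
  refine ⟨Submodule.Quotient.equiv _ _ e hmap, fun j v => ?_⟩
  obtain ⟨u, rfl⟩ := Submodule.mkQ_surjective _ v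
  change Submodule.mkQ _ (e (X.conv c j u)) = Submodule.mkQ _ (Y.conv c j (e u))
  congr 1
  rw [conv_apply, conv_apply]
  ext i
  rw [he]
  by_cases hi : i = j
  · subst hi; simp [he, hg]
  · simp [hi]

/-! ### The Okubo model of the convolution. -/

/-- The Okubo system with residues induced by the convolution matrices on `⊕ Im A_i ≅ V^p / 𝓚`. -/
abbrev okubo (X : MatTuple p) (c : ℂ) : OkuboSystem p where
  V := Submodule.pi (Set.univ : Set (Fin p)) fun i => LinearMap.range (X.op i)
  P := fun i => (LinearMap.single ℂ (fun _ : Fin p => X.V) i ∘ₗ LinearMap.proj i).restrict (by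
    intro w hw k _
    by_cases h : k = i
    · subst h; simpa using hw k trivial
    · simp [h])
  isProj := by
    refine ⟨⟨fun i => ?_, fun i j hij => ?_⟩, ?_⟩
    · refine LinearMap.ext fun w => Subtype.ext ?_
      change Pi.single i (Pi.single (M := fun _ => X.V) i (w.1 i) i) =
        Pi.single (M := fun _ => X.V) i (w.1 i)
      rw [Pi.single_eq_same]
    · refine LinearMap.ext fun w => Subtype.ext ?_
      change Pi.single (M := fun _ => X.V) i (Pi.single (M := fun _ => X.V) j (w.1 j) i) = 0
      rw [Pi.single_eq_of_ne hij, Pi.single_zero]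
    · refine LinearMap.ext fun w => Subtype.ext ?_
      rw [LinearMap.sum_apply, ← Submodule.subtype_apply, map_sum]
      exact Finset.univ_sum_single w.1
  A := LinearMap.restrict
    ((LinearMap.pi fun i => X.op i ∘ₗ ∑ k, LinearMap.proj k) + c • LinearMap.id) (by
      intro w hw k _
      have := hw k trivial
      simp only [LinearMap.add_apply, LinearMap.smul_apply, Pi.add_apply, LinearMap.pi_apply]
      exact add_mem ⟨_, rfl⟩ (Submodule.smul_mem _ _ this))

theorem okubo_A_apply (X : MatTuple p) (c : ℂ) (w : (X.okubo c).V) (i : Fin p) :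
    ((X.okubo c).A w).1 i = X.op i (∑ k, w.1 k) + c • w.1 i := by
  change X.op i ((∑ k, LinearMap.proj (φ := fun _ : Fin p => X.V) (R := ℂ) k) w.1) + c • w.1 i = _
  rw [LinearMap.sum_apply]
  rfl

theorem okubo_P_apply (X : MatTuple p) (c : ℂ) (j : Fin p) (w : (X.okubo c).V) :
    ((X.okubo c).P j w).1 = Pi.single j (w.1 j) := rfl

theorem okubo_mem (X : MatTuple p) (c : ℂ) (w : (X.okubo c).V) (i : Fin p) :
    ∃ v, X.op i v = w.1 i := w.2 i trivial

/-- The vector of `⊕ Im A_i` with components `A_i u_i`. -/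
def okuboMk (X : MatTuple p) (c : ℂ) : (Fin p → X.V) →ₗ[ℂ] (X.okubo c).V :=
  LinearMap.codRestrict _ (LinearMap.pi fun i => X.op i ∘ₗ LinearMap.proj i)
    (fun u i _ => ⟨u i, rfl⟩)

theorem okuboMk_apply (X : MatTuple p) (c : ℂ) (u : Fin p → X.V) (i : Fin p) :
    (X.okuboMk c u).1 i = X.op i (u i) := rfl

theorem okuboMk_surjective (X : MatTuple p) (c : ℂ) : Function.Surjective (X.okuboMk c) := by
  intro w
  choose u hu using X.okubo_mem c w
  exact ⟨u, Subtype.ext (funext hu)⟩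

theorem okubo_ext {X : MatTuple p} {c : ℂ} {w w' : (X.okubo c).V} (h : ∀ i, w.1 i = w'.1 i) :
    w = w' := Subtype.ext (funext h)

/-- `A` is injective as soon as `c ≠ 0` and `A_1 + ⋯ + A_p + c` is injective. -/
theorem okubo_A_injective (X : MatTuple p) {c : ℂ} (hc : c ≠ 0)
    (hX : ∀ v, (∑ i, X.op i v) + c • v = 0 → v = 0) (w : (X.okubo c).V)
    (hw : (X.okubo c).A w = 0) : w = 0 := by
  have h : ∀ i, X.op i (∑ k, w.1 k) + c • w.1 i = 0 := fun i => by
    rw [← okubo_A_apply, hw]; rfl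
  -- Summing the components of `A w = 0` gives `(A_1 + ⋯ + A_p + c) s = 0` for `s = ∑ w_k`.
  have hs : ∑ k, w.1 k = 0 := by
    apply hX
    have := Finset.sum_congr rfl fun i (_ : i ∈ Finset.univ) => h i
    rw [Finset.sum_add_distrib, ← Finset.smul_sum, Finset.sum_const_zero] at this
    exact this
  refine okubo_ext fun i => ?_
  have := h i
  rw [hs, map_zero, zero_add] at this
  exact (smul_eq_zero.mp this).resolve_left hc

end MatTuple

/-! ### Euler transformation as middle convolution. -/

namespace OkuboSystem

variable {p : ℕ}

theorem P_P_same (S : OkuboSystem p) (i : Fin p) (v : S.V) : S.P i (S.P i v) = S.P i v :=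
  LinearMap.congr_fun (S.isProj.idem i) v

theorem P_P_of_ne (S : OkuboSystem p) {i j : Fin p} (h : i ≠ j) (v : S.V) :
    S.P i (S.P j v) = 0 := LinearMap.congr_fun (S.isProj.ortho h) v

theorem sum_P (S : OkuboSystem p) (v : S.V) : ∑ i, S.P i v = v := by
  simpa [LinearMap.sum_apply] using LinearMap.congr_fun S.isProj.complete v

theorem eq_zero_of_P (S : OkuboSystem p) {v : S.V} (h : ∀ i, S.P i v = 0) : v = 0 := by
  rw [← S.sum_P v]; simp [h]

/-- The tuple induced on `V / ker A ≅ Im A` by the residues: it consists of the operators `A P_j`. -/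
abbrev imTuple (S : OkuboSystem p) : MatTuple p where
  V := LinearMap.range S.A
  op := fun j => (S.A * S.P j).restrict fun _ _ => ⟨_, rfl⟩

theorem imTuple_op_coe (S : OkuboSystem p) (j : Fin p) (v : S.imTuple.V) :
    (S.imTuple.op j v).1 = S.A (S.P j v.1) := rfl

theorem toTuple_similar_imTuple (S : OkuboSystem p) (h : ∀ v, S.A v = 0 → v = 0) :
    S.toTuple.Similar S.imTuple := by
  have hb : Function.Bijective S.A.rangeRestrict :=
    ⟨(injective_iff_map_eq_zero _).mpr fun v hv => h v (congrArg Subtype.val hv),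
      LinearMap.surjective_rangeRestrict _⟩
  exact MatTuple.Similar.of_bijective (X := S.toTuple) (Y := S.imTuple) _ hb
    fun j v => Subtype.ext rfl

theorem toTuple_similar {S T : OkuboSystem p} (e : S.V →ₗ[ℂ] T.V) (he : Function.Bijective e)
    (hP : ∀ j v, e (S.P j v) = T.P j (e v)) (hA : ∀ v, e (S.A v) = T.A (e v)) :
    S.toTuple.Similar T.toTuple := by
  refine MatTuple.Similar.of_bijective (X := S.toTuple) (Y := T.toTuple) e he fun j v => ?_
  exact (hP j (S.A v)).trans (congrArg (T.P j) (hA v))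

/-- The middle convolution of `(A P_1, …, A P_p)` on `Im A` is the Euler transform. -/
theorem mc_imTuple (S : OkuboSystem p) {c : ℂ}
    (hinj : ∀ j v, S.A (S.P j v) = 0 → S.P j v = 0)
    (hsurj : ∀ j v, ∃ w, S.P j (S.A w) = S.P j v)
    (hA : ∀ v, S.A v + c • v = 0 → v = 0) :
    (S.imTuple.mc c).Similar (S.euler c).toTuple := by
  -- With `f u = ∑ P_j u_j`, the sum `∑ A P_i u_i` is `A (f u)`, so on `f u` the `j`-th convolution
  -- operator becomes `P_j (A + c)`. The kernel of `f` turns out to be `𝓚`, which already contains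
  -- `𝓛_c` because `A + c` is injective.
  let f : (Fin p → S.imTuple.V) →ₗ[ℂ] S.V :=
    ∑ j, S.P j ∘ₗ (LinearMap.range S.A).subtype ∘ₗ LinearMap.proj j
  have hf : ∀ u, f u = ∑ j, S.P j (u j).1 := fun u => by simp [f, LinearMap.sum_apply]
  have hPf : ∀ u j, S.P j (f u) = S.P j (u j).1 := fun u j => by
    rw [hf, map_sum, Finset.sum_eq_single j, P_P_same]
    · intro i _ hij; exact S.P_P_of_ne hij.symm _
    · simp
  have hsum : ∀ u : Fin p → S.imTuple.V, (∑ i, S.imTuple.op i (u i)).1 = S.A (f u) := fun u => by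
    rw [hf, map_sum]
    exact map_sum (LinearMap.range S.A).subtype _ _
  have hf_surj : Function.Surjective f := fun v => by
    choose w hw using fun j => hsurj j v
    refine ⟨fun j => S.A.rangeRestrict (w j), (hf _).trans ?_⟩
    exact (Finset.sum_congr rfl fun j _ => hw j).trans (S.sum_P v)
  have hker : ∀ u, f u = 0 ↔ u ∈ S.imTuple.convK ⊔ S.imTuple.convL c := fun u => by
    constructor
    · intro hu
      refine Submodule.mem_sup_left (MatTuple.mem_convK.mpr fun j => Subtype.ext ?_)
      change S.A (S.P j (u j).1) = 0
      rw [← hPf, hu, map_zero, map_zero]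
    · intro hu
      obtain ⟨k, hk, l, hl, rfl⟩ := Submodule.mem_sup.mp hu
      have h1 : f k = 0 := by
        rw [hf]
        refine Finset.sum_eq_zero fun j _ => hinj j _ ?_
        exact congrArg Subtype.val (MatTuple.mem_convK.mp hk j)
      have h2 : f l = 0 := by
        apply hA
        have : ∀ j, S.P j (S.A (f l) + c • f l) = 0 := fun j => by
          have := congrArg Subtype.val (MatTuple.mem_convL.mp hl j)
          have h3 : S.A (f l) + c • (l j).1 = 0 := by rw [← hsum]; exact this
          rw [map_add, map_smul, hPf, ← map_smul, ← map_add, h3, map_zero]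
        exact S.eq_zero_of_P this
      rw [map_add, h1, h2, add_zero]
  have hop : ∀ j u, f (S.imTuple.conv c j u) = S.P j (S.A (f u) + c • f u) := fun j u => by
    rw [MatTuple.conv_apply, hf, Finset.sum_eq_single j]
    · rw [Pi.single_eq_same, map_add, map_smul, hPf, ← map_smul, ← map_add, ← hsum]; rfl
    · intro i _ hij
      rw [Pi.single_eq_of_ne hij]; exact map_zero _
    · simp
  exact MatTuple.mc_similar_of_surjective S.imTuple (S.euler c).toTuple c f hf_surj hker hop

end OkuboSystem

/-! ### Middle convolution as the image of the Okubo matrix; generic Okubo normal form. -/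

namespace MatTuple

variable {p : ℕ}

/-- The middle convolution is the quotient of `⊕ Im A_i` by the kernel of `A`. -/
theorem mc_similar_imTuple (X : MatTuple p) (c : ℂ)
    (h : c ≠ 0 ∨ ∀ v, (∀ k, X.op k v = 0) → v = 0) : (X.mc c).Similar (X.okubo c).imTuple := by
  refine mc_similar_of_surjective X (X.okubo c).imTuple c
    ((X.okubo c).A.rangeRestrict ∘ₗ X.okuboMk c) ?_ ?_ ?_
  · exact (LinearMap.surjective_rangeRestrict _).comp (X.okuboMk_surjective c)
  · intro u
    have key : ∀ i, ((X.okubo c).A (X.okuboMk c u)).1 i =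
        X.op i ((∑ k, X.op k (u k)) + c • u i) := fun i => by
      rw [okubo_A_apply, map_add, map_smul]; rfl
    have h0 : (X.okubo c).A.rangeRestrict (X.okuboMk c u) = 0 ↔
        ∀ i, X.op i ((∑ k, X.op k (u k)) + c • u i) = 0 := by
      constructor
      · intro hu i
        rw [← key, show (X.okubo c).A (X.okuboMk c u) = 0 from congrArg Subtype.val hu]; rfl
      · intro hu
        exact Subtype.ext (okubo_ext fun i => (key i).trans (hu i))
    refine h0.trans ?_
    constructor
    · intro hu
      set s := ∑ k, X.op k (u k) with hs
      by_cases hc : c = 0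
      · subst hc
        have h := h.resolve_left (not_not.mpr rfl) s fun k => by simpa using hu k
        refine Submodule.mem_sup_right (mem_convL.mpr fun j => ?_)
        rw [← hs, h, zero_smul, add_zero]
      -- Split `u_i = c⁻¹(s + c u_i) - c⁻¹ s`. The first part is in `𝓚`; the second is constant and
      -- in `𝓛_c`, since `A_i(-c⁻¹ s) = A_i u_i` sums to `s`.
      · refine Submodule.mem_sup.mpr ⟨fun i => c⁻¹ • (s + c • u i), ?_, fun _ => -c⁻¹ • s, ?_, ?_⟩
        · exact mem_convK.mpr fun j => by rw [map_smul, hu, smul_zero]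
        · refine mem_convL.mpr fun j => ?_
          have h1 : ∀ i, X.op i (-c⁻¹ • s) = X.op i (u i) := fun i => by
            have := hu i
            rw [map_add, map_smul, add_eq_zero_iff_eq_neg] at this
            rw [map_smul, this, neg_smul_neg, inv_smul_smul₀ hc]
          simp only [h1]
          rw [← hs, neg_smul, smul_neg, smul_inv_smul₀ hc, add_neg_cancel]
        · funext i
          simp [smul_add, inv_smul_smul₀ hc]
    · intro hu
      obtain ⟨k, hk, l, hl, rfl⟩ := Submodule.mem_sup.mp hu
      intro i
      have hk' := mem_convK.mp hk
      have hl' := mem_convL.mp hl i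
      simp only [Pi.add_apply, map_add, hk', zero_add, map_smul, smul_add, smul_zero] at hl' ⊢
      rw [← map_smul, ← map_add, hl', map_zero]
  · intro j u
    refine Subtype.ext ?_
    change (X.okubo c).A _ = (X.okubo c).A ((X.okubo c).P j ((X.okubo c).A _))
    congr 1
    refine okubo_ext fun i => ?_
    rw [okubo_P_apply, okuboMk_apply, conv_apply, okubo_A_apply]
    by_cases hi : i = j
    · subst hi
      rw [Pi.single_eq_same, Pi.single_eq_same, map_add, map_smul]; rfl
    · simp [hi]

theorem mc_similar_okubo (X : MatTuple p) {c : ℂ} (hc : c ≠ 0)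
    (hX : ∀ v, (∑ i, X.op i v) + c • v = 0 → v = 0) : (X.mc c).Similar (X.okubo c).toTuple :=
  (X.mc_similar_imTuple c (Or.inl hc)).trans
    ((X.okubo c).toTuple_similar_imTuple (X.okubo_A_injective hc hX)).symm

theorem finite_not_injective {V : Type} [AddCommGroup V] [Module ℂ V] [FiniteDimensional ℂ V]
    (f : End ℂ V) : {c : ℂ | ¬ ∀ v, f v + c • v = 0 → v = 0}.Finite := by
  refine (f.finite_hasEigenvalue.image Neg.neg).subset fun c hc => ?_
  simp only [Set.mem_ofPred_eq, not_forall] at hc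
  obtain ⟨v, hv, hv0⟩ := hc
  refine ⟨-c, ?_, neg_neg c⟩
  refine End.hasEigenvalue_of_hasEigenvector (x := v) ⟨?_, hv0⟩
  rw [End.mem_eigenspace_iff, neg_smul]
  exact eq_neg_of_add_eq_zero_left hv

/-- Away from `0` and the negatives of the eigenvalues of `A_1 + ⋯ + A_p`, the Okubo matrix is
injective, so the convolution is the Okubo model itself. -/
theorem finite_not_isONF (X : MatTuple p) : {c : ℂ | ¬ (X.mc c).IsONF}.Finite := by
  refine ((Set.finite_singleton (0 : ℂ)).union (finite_not_injective (∑ i, X.op i))).subset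
    fun c hc => ?_
  by_contra h
  simp only [Set.mem_union, Set.mem_singleton_iff, Set.mem_ofPred_eq, not_or, not_not,
    LinearMap.sum_apply] at h
  exact hc ⟨_, X.mc_similar_okubo h.1 h.2⟩

end MatTuple

/-! ### Admissible tuples. -/

namespace MatTuple

variable {p : ℕ}

/-- Irreducible tuples on a nonzero space satisfying the two genericity conditions under which
middle convolution is invertible; they exclude the one-dimensional tuples with at most one nonzero
entry. -/
structure Admissible (X : MatTuple p) : Prop where
  nontrivial : Nontrivial X.V
  irreducible : X.IsIrreducible
  ker : ∀ (i : Fin p) (τ : ℂ) (v : X.V), (∀ k, k ≠ i → X.op k v = 0) → X.op i v = τ • v → v = 0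
  range : ∀ (i : Fin p) (τ : ℂ) (W : Submodule ℂ X.V), (∀ k, k ≠ i → ∀ v, X.op k v ∈ W) →
    (∀ v, X.op i v - τ • v ∈ W) → W = ⊤

theorem Admissible.eq_zero [NeZero p] {X : MatTuple p} (h : X.Admissible) (v : X.V)
    (hv : ∀ k, X.op k v = 0) : v = 0 :=
  h.ker 0 0 v (fun k _ => hv k) (by rw [hv, zero_smul])

theorem Admissible.eq_top [NeZero p] {X : MatTuple p} (h : X.Admissible) (W : Submodule ℂ X.V)
    (hW : ∀ k v, X.op k v ∈ W) : W = ⊤ :=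
  h.range 0 0 W (fun k _ => hW k) (fun v => by rw [zero_smul, sub_zero]; exact hW 0 v)

theorem IsIrreducible.of_similar {X Y : MatTuple p} (h : X.Similar Y) (hX : X.IsIrreducible) :
    Y.IsIrreducible := by
  obtain ⟨g, hg⟩ := h
  intro W hW
  have hmap : (W.comap (g : X.V →ₗ[ℂ] Y.V)).map (g : X.V →ₗ[ℂ] Y.V) = W :=
    Submodule.map_comap_eq_of_surjective g.surjective W
  rcases hX (W.comap (g : X.V →ₗ[ℂ] Y.V)) fun j v hv => by
    change g (X.op j v) ∈ W
    rw [hg]; exact hW j _ hv with h | h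
  · left; rw [← hmap, h, Submodule.map_bot]
  · right; rw [← hmap, h, Submodule.map_top, LinearMap.range_eq_top]; exact g.surjective

theorem Admissible.of_similar {X Y : MatTuple p} (h : X.Similar Y) (hX : X.Admissible) :
    Y.Admissible := by
  have hirr := hX.irreducible.of_similar h
  obtain ⟨g, hg⟩ := h
  have hg' : ∀ j w, g.symm (Y.op j w) = X.op j (g.symm w) := fun j w => by
    rw [g.symm_apply_eq, hg, g.apply_symm_apply]
  have := hX.nontrivial
  refine ⟨g.symm.toEquiv.nontrivial, hirr, fun i τ v h1 h2 => ?_, fun i τ W h1 h2 => ?_⟩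
  · rw [← g.symm.map_eq_zero_iff]
    refine hX.ker i τ _ (fun k hk => ?_) ?_
    · rw [← hg', h1 k hk, map_zero]
    · rw [← hg', h2, map_smul]
  · have := hX.range i τ (W.comap (g : X.V →ₗ[ℂ] Y.V)) (fun k hk v => ?_) fun v => ?_
    · rw [← Submodule.map_comap_eq_of_surjective (f := (g : X.V →ₗ[ℂ] Y.V)) g.surjective W, this,
        Submodule.map_top, LinearMap.range_eq_top]
      exact g.surjective
    · change g (X.op k v) ∈ W
      rw [hg]; exact h1 k hk _
    · change g (X.op i v - τ • v) ∈ W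
      rw [map_sub, map_smul, hg]; exact h2 _

theorem Admissible.perm {X : MatTuple p} (h : X.Admissible) (σ : Equiv.Perm (Fin p)) :
    (X.perm σ).Admissible := by
  have hσ : ∀ {Q : Fin p → Prop} (i : Fin p), (∀ k, k ≠ i → Q (σ k)) → ∀ k, k ≠ σ i → Q k :=
    fun i hQ k hk => by
      have := hQ (σ.symm k) fun e => hk (by rw [← e, σ.apply_symm_apply])
      rwa [σ.apply_symm_apply] at this
  refine ⟨h.nontrivial, fun W hW => h.irreducible W fun j v hv => ?_, fun i τ v h1 h2 => ?_,
    fun i τ W h1 h2 => ?_⟩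
  · have : X.op (σ (σ.symm j)) v ∈ W := hW (σ.symm j) v hv
    rwa [σ.apply_symm_apply] at this
  · exact h.ker (σ i) τ v (hσ (Q := fun k => X.op k v = 0) i h1) h2
  · exact h.range (σ i) τ W (hσ (Q := fun k => ∀ v, X.op k v ∈ W) i h1) h2

/-- Irreducible tuples on a space of dimension at least two are admissible. -/
theorem IsIrreducible.admissible {X : MatTuple p} (h : X.IsIrreducible)
    (hd : 2 ≤ finrank ℂ X.V) : X.Admissible := by
  have hnt : Nontrivial X.V := nontrivial_of_finrank_pos (R := ℂ) (by omega)
  -- A common eigenvector would span an invariant line, which is proper in dimension at least two.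
  have hline : ∀ v : X.V, (∀ k, ∃ c : ℂ, X.op k v = c • v) → v = 0 := fun v hv => by
    by_contra hv0
    rcases h (Submodule.span ℂ {v}) fun j w hw => by
      obtain ⟨a, rfl⟩ := Submodule.mem_span_singleton.mp hw
      obtain ⟨c, hc⟩ := hv j
      rw [map_smul, hc]
      exact Submodule.smul_mem _ _ (Submodule.smul_mem _ _ (Submodule.mem_span_singleton_self v))
      with h | h
    · exact hv0 (Submodule.span_singleton_eq_bot.mp h)
    · have := finrank_span_singleton (K := ℂ) hv0
      rw [h, finrank_top] at this
      omega
  refine ⟨hnt, h, fun i τ v h1 h2 => hline v fun k => ?_, fun i τ W h1 h2 => ?_⟩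
  · by_cases hk : k = i
    · subst hk; exact ⟨τ, h2⟩
    · exact ⟨0, by rw [h1 k hk, zero_smul]⟩
  -- `R` is the smallest subspace meeting the two range requirements. It is invariant, and if it
  -- were zero, every vector would be a common eigenvector.
  · set R : Submodule ℂ X.V :=
      (⨆ k : {k // k ≠ i}, LinearMap.range (X.op k)) ⊔
        LinearMap.range (X.op i - τ • (1 : End ℂ X.V)) with hR
    have hRk : ∀ k, k ≠ i → ∀ v, X.op k v ∈ R := fun k hk v =>
      Submodule.mem_sup_left (Submodule.mem_iSup_of_mem (⟨k, hk⟩ : {k // k ≠ i}) ⟨v, rfl⟩)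
    have hRi : ∀ v, X.op i v - τ • v ∈ R := fun v => Submodule.mem_sup_right ⟨v, rfl⟩
    have hRW : R ≤ W := by
      refine sup_le (iSup_le fun k => ?_) ?_
      · rintro _ ⟨v, rfl⟩; exact h1 k k.2 v
      · rintro _ ⟨v, rfl⟩; exact h2 v
    rcases h R fun j v hv => by
      by_cases hj : j = i
      · subst hj
        rw [← sub_add_cancel (X.op j v) (τ • v)]
        exact add_mem (hRi v) (Submodule.smul_mem _ _ hv)
      · exact hRk j hj v
      with h0 | h0
    · obtain ⟨v, hv⟩ := exists_ne (0 : X.V)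
      refine absurd (hline v fun k => ?_) hv
      by_cases hk : k = i
      · subst hk
        have := hRi v
        rw [h0, Submodule.mem_bot, sub_eq_zero] at this
        exact ⟨τ, this⟩
      · have := hRk k hk v
        rw [h0, Submodule.mem_bot] at this
        exact ⟨0, by rw [this, zero_smul]⟩
    · exact top_le_iff.mp (h0 ▸ hRW)

/-! ### Middle convolution of admissible tuples -/

/-- The vector of `⊕ Im A_i` concentrated in one component. -/
def okuboSingle (X : MatTuple p) (c : ℂ) (i : Fin p) (v : X.V) : (X.okubo c).V :=
  X.okuboMk c (Pi.single i v)

theorem okuboSingle_same (X : MatTuple p) (c : ℂ) (i : Fin p) (v : X.V) :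
    (X.okuboSingle c i v).1 i = X.op i v := by
  rw [okuboSingle, okuboMk_apply, Pi.single_eq_same]

theorem okuboSingle_ne (X : MatTuple p) (c : ℂ) {i k : Fin p} (h : k ≠ i) (v : X.V) :
    (X.okuboSingle c i v).1 k = 0 := by
  rw [okuboSingle, okuboMk_apply, Pi.single_eq_of_ne h, map_zero]

theorem sum_okuboSingle (X : MatTuple p) (c : ℂ) (i : Fin p) (v : X.V) :
    ∑ k, (X.okuboSingle c i v).1 k = X.op i v := by
  rw [Finset.sum_eq_single i (fun k _ hk => X.okuboSingle_ne c hk v) (by simp), okuboSingle_same]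

theorem okubo_A_single_same (X : MatTuple p) (c : ℂ) (i : Fin p) (v : X.V) :
    ((X.okubo c).A (X.okuboSingle c i v)).1 i = X.op i (X.op i v + c • v) := by
  rw [okubo_A_apply, sum_okuboSingle, okuboSingle_same, map_add, map_smul]

theorem okubo_A_single_ne (X : MatTuple p) (c : ℂ) {i k : Fin p} (h : k ≠ i) (v : X.V) :
    ((X.okubo c).A (X.okuboSingle c i v)).1 k = X.op k (X.op i v) := by
  rw [okubo_A_apply, sum_okuboSingle, okuboSingle_ne X c h, smul_zero, add_zero]

theorem okubo_P_eq_single (X : MatTuple p) (c : ℂ) (i : Fin p) {w : (X.okubo c).V} {v : X.V}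
    (h : X.op i v = w.1 i) : (X.okubo c).P i w = X.okuboSingle c i v := by
  refine okubo_ext fun k => ?_
  rw [okubo_P_apply]
  by_cases hk : k = i
  · subst hk; rw [okuboSingle_same, Pi.single_eq_same, h]
  · rw [okuboSingle_ne X c hk, Pi.single_eq_of_ne hk]

/-- With `w_i = A_i v`, the components of `A P_i w` are `A_k A_i v` for `k ≠ i` and `(A_i + c) A_i
v`; if all vanish, the kernel condition with `τ = -c` applies to `A_i v`. -/
theorem Admissible.eq_zero_of_okubo_A_P {X : MatTuple p} (h : X.Admissible) (c : ℂ) (i : Fin p)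
    (w : (X.okubo c).V) (hw : (X.okubo c).A ((X.okubo c).P i w) = 0) : (X.okubo c).P i w = 0 := by
  obtain ⟨v, hv⟩ := X.okubo_mem c w i
  rw [X.okubo_P_eq_single c i hv] at hw ⊢
  have h0 : X.op i v = 0 := by
    refine h.ker i (-c) _ (fun k hk => ?_) ?_
    · rw [← okubo_A_single_ne X c hk, hw]; rfl
    · have := okubo_A_single_same X c i v
      rw [hw, map_add, map_smul] at this
      rw [neg_smul]
      exact eq_neg_of_add_eq_zero_left this.symm
  refine okubo_ext fun k => ?_
  by_cases hk : k = i
  · subst hk; rw [okuboSingle_same, h0]; rfl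
  · rw [okuboSingle_ne X c hk]; rfl

/-- The `i`-th row of `A + τ` covers `Im A_i`: on vectors with a single component it yields `A_i A_k
v` for `k ≠ i` and `A_i (A_i + c + τ) v`, so the range condition with value `-(c + τ)` applies. -/
theorem Admissible.exists_okubo_A {X : MatTuple p} (h : X.Admissible) (c τ : ℂ) (i : Fin p)
    (v : X.V) : ∃ w : (X.okubo c).V, ((X.okubo c).A w).1 i + τ • w.1 i = X.op i v := by
  let f : (X.okubo c).V →ₗ[ℂ] X.V :=
    LinearMap.proj i ∘ₗ (Submodule.subtype _) ∘ₗ ((X.okubo c).A + τ • LinearMap.id)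
  have hf : ∀ w, f w = ((X.okubo c).A w).1 i + τ • w.1 i := fun w => rfl
  have := h.range i (-(c + τ)) ((LinearMap.range f).comap (X.op i)) (fun k hk v => ?_) fun v => ?_
  · have hv : v ∈ (LinearMap.range f).comap (X.op i) := by rw [this]; trivial
    exact hv
  · exact ⟨X.okuboSingle c k v, by
      rw [hf, okubo_A_single_ne X c hk.symm, okuboSingle_ne X c hk.symm, smul_zero, add_zero]⟩
  · refine ⟨X.okuboSingle c i v, ?_⟩
    rw [hf, okubo_A_single_same, okuboSingle_same, neg_smul, sub_neg_eq_add, add_smul]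
    simp only [map_add, map_smul, add_assoc]

theorem Admissible.exists_okubo_P_A {X : MatTuple p} (h : X.Admissible) (c : ℂ) (i : Fin p)
    (w : (X.okubo c).V) : ∃ w', (X.okubo c).P i ((X.okubo c).A w') = (X.okubo c).P i w := by
  obtain ⟨v, hv⟩ := X.okubo_mem c w i
  obtain ⟨w', hw'⟩ := h.exists_okubo_A c 0 i v
  refine ⟨w', Subtype.ext ?_⟩
  rw [okubo_P_apply, okubo_P_apply, ← hv, ← hw', zero_smul, add_zero]

/-- If `A = d`, every `A_i v` is killed by the other entries and is an eigenvector of `A_i` with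
value `d - c`, hence zero; then all entries vanish. -/
theorem Admissible.okubo_A_ne_smul [NeZero p] {X : MatTuple p} (h : X.Admissible) (c d : ℂ) :
    (X.okubo c).A ≠ d • 1 := by
  intro hA
  have hX : ∀ i v, X.op i v = 0 := fun i v => by
    refine h.ker i (d - c) _ (fun k hk => ?_) ?_
    · rw [← okubo_A_single_ne X c hk, hA]
      exact (congrArg (d • ·) (okuboSingle_ne X c hk v)).trans (smul_zero d)
    · have := okubo_A_single_same X c i v
      rw [hA, map_add, map_smul] at this
      have h2 : d • X.op i v = X.op i (X.op i v) + c • X.op i v :=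
        (congrArg (d • ·) (okuboSingle_same X c i v)).symm.trans this
      rw [sub_smul, h2, add_sub_cancel_right]
  have := h.nontrivial
  obtain ⟨v, hv⟩ := exists_ne (0 : X.V)
  exact hv (h.eq_zero v fun k => hX k v)

/-- Through `mc_similar_imTuple` this says that middle convolution preserves admissibility. The
kernel and range conditions at `τ` come from those of `X` at `τ - c`. -/
theorem Admissible.okubo_imTuple [NeZero p] {X : MatTuple p} (h : X.Admissible) (c : ℂ) :
    (X.okubo c).imTuple.Admissible := by
  refine ⟨?_, ?_, ?_, ?_⟩
  · by_contra hn
    refine h.okubo_A_ne_smul c 0 (LinearMap.ext fun w => ?_)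
    rw [not_nontrivial_iff_subsingleton] at hn
    rw [zero_smul]
    exact congrArg Subtype.val (hn.elim ((X.okubo c).A.rangeRestrict w) 0)
  · intro M hM
    -- the `k`-th components of elements of `M`
    let N : Fin p → Submodule ℂ X.V := fun k => M.map
      (LinearMap.proj (φ := fun _ : Fin p => X.V) k ∘ₗ
        (Submodule.pi (Set.univ : Set (Fin p)) fun i => LinearMap.range (X.op i)).subtype ∘ₗ
          (LinearMap.range (X.okubo c).A).subtype)
    have hN : ∀ {k n}, n ∈ N k ↔ ∃ y ∈ M, y.1.1 k = n := Iff.rfl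
    have hAP : ∀ y ∈ M, ∀ k, ∃ y' ∈ M, y'.1 = (X.okubo c).A ((X.okubo c).P k y.1) :=
      fun y hy k => ⟨_, hM k y hy, rfl⟩
    have hstep : ∀ k j n, n ∈ N j → X.op k n ∈ N k := by
      intro k j n hn
      obtain ⟨y, hy, rfl⟩ := hN.mp hn
      obtain ⟨y', hy', he⟩ := hAP y hy j
      obtain ⟨v, hv⟩ := X.okubo_mem c y.1 j
      rw [X.okubo_P_eq_single c j hv] at he
      rw [← hv] at hn ⊢
      have h1 : y'.1.1 k ∈ N k := ⟨y', hy', rfl⟩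
      rw [he] at h1
      by_cases hk : k = j
      · subst hk
        rw [okubo_A_single_same, map_add, map_smul] at h1
        rw [← add_sub_cancel_right (X.op k (X.op k v)) (c • X.op k v)]
        exact sub_mem h1 (Submodule.smul_mem _ _ hn)
      · rwa [okubo_A_single_ne X c hk] at h1
    -- Since `A_k N_j ⊆ N_k`, the subspace `U` is invariant and contains every `N_j`. If `U = 0`
    -- then `M = 0`; if `U = V` then each `Im A_k` lies in `N_k`, which forces `A P_k w ∈ M` for all
    -- `w`.
    let U : Submodule ℂ X.V := ⨅ k, (N k).comap (X.op k)
    have hU : ∀ {v}, v ∈ U ↔ ∀ k, X.op k v ∈ N k := by simp [U]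
    rcases h.irreducible U fun j v hv => hU.mpr fun k => hstep k j _ (hU.mp hv j) with h0 | h0
    · left
      refine (Submodule.eq_bot_iff M).mpr fun y hy => Subtype.ext (okubo_ext fun k => ?_)
      have : y.1.1 k ∈ U := hU.mpr fun i => hstep i k _ ⟨y, hy, rfl⟩
      rwa [h0, Submodule.mem_bot] at this
    · right
      refine Submodule.eq_top_iff'.mpr fun y => ?_
      obtain ⟨_, w, rfl⟩ := y
      have hw : (X.okubo c).A.rangeRestrict w ∈ M := by
        rw [← (X.okubo c).sum_P w, map_sum]
        refine Submodule.sum_mem _ fun k _ => ?_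
        obtain ⟨v, hv⟩ := X.okubo_mem c w k
        have hvU : v ∈ U := by rw [h0]; trivial
        obtain ⟨y, hy, hyk⟩ := hN.mp (hU.mp hvU k)
        obtain ⟨y', hy', he⟩ := hAP y hy k
        have hP : (X.okubo c).P k w = (X.okubo c).P k y.1 := by
          refine Subtype.ext ?_
          rw [okubo_P_apply, okubo_P_apply, ← hv, ← hyk]
        rw [hP]
        have : (X.okubo c).A.rangeRestrict ((X.okubo c).P k y.1) = y' := Subtype.ext he.symm
        rw [this]; exact hy'
      exact hw
  · intro i τ y h1 h2
    have hAk : ∀ k, k ≠ i → (X.okubo c).P k y.1 = 0 := fun k hk =>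
      h.eq_zero_of_okubo_A_P c k _ (congrArg Subtype.val (h1 k hk))
    have hyi : ∀ k, k ≠ i → y.1.1 k = 0 := fun k hk => by
      have := congrFun (congrArg Subtype.val (hAk k hk)) k
      rw [okubo_P_apply, Pi.single_eq_same] at this
      exact this
    obtain ⟨v, hv⟩ := X.okubo_mem c y.1 i
    have hy : (X.okubo c).A (X.okuboSingle c i v) = τ • y.1 := by
      rw [← X.okubo_P_eq_single c i hv]; exact congrArg Subtype.val h2
    have h0 : X.op i v = 0 := by
      refine h.ker i (τ - c) _ (fun k hk => ?_) ?_
      · rw [← okubo_A_single_ne X c hk, hy]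
        exact (congrArg (τ • ·) (hyi k hk)).trans (smul_zero τ)
      · have := okubo_A_single_same X c i v
        rw [hy, map_add, map_smul] at this
        have h3 : τ • X.op i v = X.op i (X.op i v) + c • X.op i v :=
          (congrArg (τ • ·) hv).trans this
        rw [sub_smul, h3, add_sub_cancel_right]
    refine Subtype.ext (okubo_ext fun k => ?_)
    by_cases hk : k = i
    · subst hk; rw [← hv, h0]; rfl
    · rw [hyi k hk]; rfl
  · intro i τ W h1 h2
    -- `A` composed with the inclusion of the components
    let e : Fin p → X.V →ₗ[ℂ] (X.okubo c).imTuple.V := fun k =>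
      (X.okubo c).A.rangeRestrict ∘ₗ X.okuboMk c ∘ₗ LinearMap.single ℂ (fun _ => X.V) k
    have he : ∀ k v, (e k v).1 = (X.okubo c).A (X.okuboSingle c k v) := fun k v => rfl
    have hop : ∀ k w v, X.op k v = ((X.okubo c).A w).1 k →
        (X.okubo c).imTuple.op k ((X.okubo c).A.rangeRestrict w) = e k v := fun k w v hv => by
      refine Subtype.ext ?_
      rw [he, ← X.okubo_P_eq_single c k hv]; rfl
    -- The `k`-th row of `A` covers `Im A_k`, so `e k v` is a value of the `k`-th operator.
    have hk : ∀ k, k ≠ i → ∀ v, e k v ∈ W := fun k hk v => by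
      obtain ⟨w, hw⟩ := h.exists_okubo_A c 0 k v
      rw [zero_smul, add_zero] at hw
      rw [← hop k w v hw.symm]
      exact h1 k hk _
    have hi : ∀ v, e i v ∈ W := fun v => by
      have := h.range i (-(c - τ)) (W.comap (e i)) (fun k hki u => ?_) fun u => ?_
      · have hv : v ∈ W.comap (e i) := by rw [this]; trivial
        exact hv
      · have h3 := h2 (e k u)
        have h4 : (X.okubo c).imTuple.op i (e k u) = e i (X.op k u) :=
          hop i (X.okuboSingle c k u) _ (okubo_A_single_ne X c hki.symm u).symm
        rw [h4] at h3
        have := add_mem h3 (Submodule.smul_mem _ τ (hk k hki u))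
        rwa [sub_add_cancel] at this
      · have h3 := h2 (e i u)
        have h4 : (X.okubo c).imTuple.op i (e i u) = e i (X.op i u + c • u) :=
          hop i (X.okuboSingle c i u) _ (okubo_A_single_same X c i u).symm
        rw [h4, ← map_smul, ← map_sub] at h3
        have h5 : X.op i u - -(c - τ) • u = X.op i u + c • u - τ • u := by module
        rw [h5]; exact h3
    refine Submodule.eq_top_iff'.mpr fun y => ?_
    obtain ⟨_, w, rfl⟩ := y
    have hw : (X.okubo c).A.rangeRestrict w ∈ W := by
      rw [← (X.okubo c).sum_P w, map_sum]
      refine Submodule.sum_mem _ fun k _ => ?_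
      obtain ⟨v, hv⟩ := X.okubo_mem c w k
      rw [X.okubo_P_eq_single c k hv]
      by_cases hki : k = i
      · subst hki; exact hi v
      · exact hk k hki v
    exact hw

theorem Admissible.mc_similar_imTuple [NeZero p] {X : MatTuple p} (h : X.Admissible) (c : ℂ) :
    (X.mc c).Similar (X.okubo c).imTuple :=
  X.mc_similar_imTuple c (Or.inr h.eq_zero)

theorem Admissible.mc [NeZero p] {X : MatTuple p} (h : X.Admissible) (c : ℂ) :
    (X.mc c).Admissible :=
  (h.okubo_imTuple c).of_similar (h.mc_similar_imTuple c).symm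

theorem Admissible.okubo_toTuple [NeZero p] {X : MatTuple p} (h : X.Admissible) {c : ℂ}
    (hA : ∀ w, (X.okubo c).A w = 0 → w = 0) : (X.okubo c).toTuple.Admissible :=
  (h.okubo_imTuple c).of_similar ((X.okubo c).toTuple_similar_imTuple hA).symm

theorem okubo_euler (X : MatTuple p) (c d : ℂ) :
    ((X.okubo c).euler d).toTuple.Similar (X.okubo (c + d)).toTuple := by
  refine OkuboSystem.toTuple_similar (S := (X.okubo c).euler d) (T := X.okubo (c + d))
    (LinearMap.id (R := ℂ) (M := (X.okubo c).V)) Function.bijective_id (fun j v => rfl) fun v => ?_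
  refine okubo_ext fun i => ?_
  rw [okubo_A_apply]
  refine (congrArg (· + d • v.1 i) (X.okubo_A_apply c v i)).trans ?_
  rw [add_smul, ← add_assoc]
  rfl

/-- `mc_d ∘ mc_c = mc_{c+d}`, for generic `d`. -/
theorem Admissible.mc_mc [NeZero p] {X : MatTuple p} (h : X.Admissible) {c d : ℂ}
    (hcd : c + d ≠ 0) (hX : ∀ v, (∑ i, X.op i v) + (c + d) • v = 0 → v = 0) :
    ((X.mc c).mc d).Similar (X.mc (c + d)) := by
  -- `mc_c(X)` is the image tuple of `okubo X c`; its convolution by `d` is the Euler transform of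
  -- that system, namely `okubo X (c + d)`.
  refine ((h.mc_similar_imTuple c).mc d).trans ?_
  refine (OkuboSystem.mc_imTuple _ (h.eq_zero_of_okubo_A_P c) (h.exists_okubo_P_A c) ?_).trans ?_
  · intro w hw
    refine X.okubo_A_injective hcd hX w (okubo_ext fun i => ?_)
    have := congrFun (congrArg Subtype.val hw) i
    refine (X.okubo_A_apply (c + d) w i).trans ?_
    rw [add_smul, ← add_assoc, ← X.okubo_A_apply c w i]
    exact this
  · exact (X.okubo_euler c d).trans (X.mc_similar_okubo hcd hX).symm

theorem Admissible.exists_sum_eq [NeZero p] {X : MatTuple p} (h : X.Admissible) (c : ℂ)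
    (v : X.V) : ∃ w : (X.okubo c).V, ∑ k, w.1 k = v := by
  let f : (X.okubo c).V →ₗ[ℂ] X.V :=
    (∑ k, LinearMap.proj (φ := fun _ : Fin p => X.V) k) ∘ₗ Submodule.subtype _
  have hf : ∀ w, f w = ∑ k, w.1 k := fun w => by
    change (∑ k, LinearMap.proj (φ := fun _ : Fin p => X.V) (R := ℂ) k) w.1 = _
    rw [LinearMap.sum_apply]; rfl
  have := h.eq_top (LinearMap.range f) fun k v =>
    ⟨X.okuboSingle c k v, by rw [hf, sum_okuboSingle]⟩
  obtain ⟨w, hw⟩ := LinearMap.range_eq_top.mp this v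
  exact ⟨w, (hf w).symm.trans hw⟩

/-- For `c = 0` the matrix is `w ↦ ι(∑ w_k)` with `ι v = (A_i v)_i`. The kernel condition makes `ι`
injective, and the range condition makes `w ↦ ∑ w_k` surjective, so `ι` identifies `V` with `Im A`.
-/
theorem Admissible.mc_zero [NeZero p] {X : MatTuple p} (h : X.Admissible) :
    (X.mc 0).Similar X := by
  have hA : ∀ w i, ((X.okubo 0).A w).1 i = X.op i (∑ k, w.1 k) := fun w i => by
    rw [okubo_A_apply, zero_smul, add_zero]
  let ι : X.V →ₗ[ℂ] (X.okubo 0).imTuple.V :=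
    LinearMap.codRestrict _ (X.okuboMk 0 ∘ₗ LinearMap.pi fun _ => LinearMap.id) (fun v => by
      obtain ⟨w, hw⟩ := h.exists_sum_eq 0 v
      exact ⟨w, okubo_ext fun i => by rw [hA, hw]; rfl⟩)
  have hι : ∀ v i, (ι v).1.1 i = X.op i v := fun v i => rfl
  refine (h.mc_similar_imTuple 0).trans (Similar.symm (Similar.of_bijective ι ⟨?_, ?_⟩ ?_))
  · refine (injective_iff_map_eq_zero _).mpr fun v hv => h.eq_zero v fun k => ?_
    rw [← hι, hv]; rfl
  · rintro ⟨_, w, rfl⟩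
    exact ⟨∑ k, w.1 k, Subtype.ext (okubo_ext fun i => by rw [hι, hA])⟩
  · intro j v
    refine Subtype.ext (okubo_ext fun i => ?_)
    rw [hι, OkuboSystem.imTuple_op_coe, okubo_P_eq_single X 0 j (v := v) (hι v j).symm, hA,
      sum_okuboSingle]

end MatTuple

/-! ### Okubo systems with admissible residues. -/

namespace OkuboSystem

variable {p : ℕ}

theorem A_injective_of_admissible [NeZero p] {S : OkuboSystem p} (h : S.toTuple.Admissible)
    (v : S.V) (hv : S.A v = 0) : v = 0 :=
  h.eq_zero v fun k => (congrArg (S.P k) hv).trans (map_zero _)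

theorem A_surjective_of_admissible [NeZero p] {S : OkuboSystem p} (h : S.toTuple.Admissible) :
    Function.Surjective S.A :=
  LinearMap.injective_iff_surjective.mp
    ((injective_iff_map_eq_zero _).mpr (A_injective_of_admissible h))

theorem finrank_range_mul {V : Type} [AddCommGroup V] [Module ℂ V] [FiniteDimensional ℂ V]
    (f g : End ℂ V) (h : ∀ v, f (g v) = 0 → g v = 0) :
    finrank ℂ (LinearMap.range (f * g)) = finrank ℂ (LinearMap.range g) := by
  have hk : LinearMap.ker (f * g) = LinearMap.ker g := by
    ext v
    exact ⟨h v, fun hv => (congrArg f hv).trans (map_zero f)⟩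
  have h1 := LinearMap.finrank_range_add_finrank_ker (f * g)
  have h2 := LinearMap.finrank_range_add_finrank_ker g
  rw [hk] at h1
  omega

/-- Condition (*) is admissibility of the residues read blockwise: injectivity of `A + τ` on `V_i`
is the kernel condition at `-τ`, and surjectivity of `P_i (A + τ)` onto `V_i` is the range condition
at `-τ` for a preimage under `P_i`. -/
theorem rankCondition_of_admissible [NeZero p] {S : OkuboSystem p} (h : S.toTuple.Admissible) :
    S.RankCondition := by
  refine ⟨?_, fun i τ => ⟨finrank_range_mul _ _ fun v hv => ?_, ?_⟩⟩
  · rw [LinearMap.range_eq_top.mpr (A_surjective_of_admissible h), finrank_top]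
  · have hA : S.A (S.P i v) = -τ • S.P i v := by
      rw [neg_smul]; exact eq_neg_of_add_eq_zero_left hv
    refine h.ker i (-τ) (S.P i v) (fun k hk => ?_) ?_
    · refine (congrArg (S.P k) hA).trans ?_
      rw [map_smul, S.P_P_of_ne hk, smul_zero]; rfl
    · refine (congrArg (S.P i) hA).trans ?_
      rw [map_smul, S.P_P_same]; rfl
  · refine congrArg (fun W : Submodule ℂ S.V => finrank ℂ W) (le_antisymm ?_ ?_)
    · rintro _ ⟨v, rfl⟩; exact ⟨_, rfl⟩
    · let R := LinearMap.range (S.P i * (S.A + τ • (1 : End ℂ S.V)))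
      have hR : ∀ v, S.P i (S.A v + τ • v) ∈ R := fun v => ⟨v, rfl⟩
      have h1 : ∀ k, k ≠ i → ∀ v, S.P k (S.A v) ∈ R.comap (S.P i) := fun k hk v => by
        rw [Submodule.mem_comap, S.P_P_of_ne hk.symm]; exact zero_mem _
      have h2 : ∀ v, S.P i (S.A v) - -τ • v ∈ R.comap (S.P i) := fun v => by
        rw [Submodule.mem_comap, map_sub, S.P_P_same, ← map_sub, neg_smul, sub_neg_eq_add]
        exact hR v
      have : R.comap (S.P i) = ⊤ := h.range i (-τ) (R.comap (S.P i)) h1 h2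
      rintro _ ⟨v, rfl⟩
      have hv : v ∈ R.comap (S.P i) := by rw [this]; trivial
      exact hv

theorem mc_toTuple [NeZero p] {S : OkuboSystem p} (h : S.toTuple.Admissible) {c : ℂ}
    (hc : ∀ v, S.A v + c • v = 0 → v = 0) : (S.toTuple.mc c).Similar (S.euler c).toTuple := by
  refine ((S.toTuple_similar_imTuple (A_injective_of_admissible h)).mc c).trans
    (S.mc_imTuple (fun j v => A_injective_of_admissible h _) (fun j v => ?_) hc)
  obtain ⟨w, rfl⟩ := A_surjective_of_admissible h v
  exact ⟨w, rfl⟩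

/-- In dimension one only one block is nonzero, so only one residue can be nonzero, against the
kernel condition. -/
theorem two_le_finrank_of_admissible [NeZero p] {S : OkuboSystem p} (h : S.toTuple.Admissible) :
    2 ≤ finrank ℂ S.V := by
  have hnt : Nontrivial S.V := h.nontrivial
  by_contra hlt
  have h1 : finrank ℂ S.V = 1 := by
    have := finrank_pos (R := ℂ) (M := S.V)
    omega
  obtain ⟨v, hv⟩ := exists_ne (0 : S.V)
  have hspan := (finrank_eq_one_iff_of_nonzero' v hv).mp h1
  obtain ⟨i, hi⟩ : ∃ i, S.P i v ≠ 0 := by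
    by_contra hn
    push Not at hn
    exact hv (S.eq_zero_of_P hn)
  obtain ⟨a, ha⟩ := hspan (S.P i v)
  have ha0 : a ≠ 0 := fun h0 => hi (by rw [← ha, h0, zero_smul])
  have hk : ∀ k, k ≠ i → ∀ w, S.P k w = 0 := fun k hk w => by
    obtain ⟨b, rfl⟩ := hspan w
    have := S.P_P_of_ne hk v
    rw [← ha, map_smul, smul_eq_zero] at this
    rw [map_smul, this.resolve_left ha0, smul_zero]
  obtain ⟨b, hb⟩ := hspan (S.P i (S.A v))
  exact hv (h.ker i b v (fun k hki => hk k hki _) hb.symm)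

end OkuboSystem

/-! ### Replacing an entry by, or appending, `ν - (A_1 + ⋯ + A_p)`. -/

namespace MatTuple

variable {p : ℕ}

/-- The `j`-th entry is replaced by `ν - (A_1 + ⋯ + A_p)`. -/
abbrev shiftedSwap (X : MatTuple p) (j : Fin p) (ν : ℂ) : MatTuple p where
  V := X.V
  op := Function.update X.op j (ν • 1 - ∑ i, X.op i)

theorem shiftedSwap_same (X : MatTuple p) (j : Fin p) (ν : ℂ) (v : X.V) :
    (X.shiftedSwap j ν).op j v = ν • v - ∑ i, X.op i v := by
  change Function.update X.op j (ν • 1 - ∑ i, X.op i) j v = _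
  rw [Function.update_self, LinearMap.sub_apply, LinearMap.sum_apply]
  rfl

theorem shiftedSwap_ne (X : MatTuple p) {j k : Fin p} (h : k ≠ j) (ν : ℂ) (v : X.V) :
    (X.shiftedSwap j ν).op k v = X.op k v := by
  change Function.update X.op j (ν • 1 - ∑ i, X.op i) k v = _
  rw [Function.update_of_ne h]

theorem sum_shiftedSwap (X : MatTuple p) (j : Fin p) (ν : ℂ) (v : X.V) :
    ∑ i, (X.shiftedSwap j ν).op i v = ν • v - X.op j v := by
  have h1 := Finset.add_sum_erase Finset.univ (fun i => (X.shiftedSwap j ν).op i v)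
    (Finset.mem_univ j)
  have h2 := Finset.add_sum_erase Finset.univ (fun i => X.op i v) (Finset.mem_univ j)
  have h3 : ∑ i ∈ Finset.univ.erase j, (X.shiftedSwap j ν).op i v =
      ∑ i ∈ Finset.univ.erase j, X.op i v :=
    Finset.sum_congr rfl fun i hi => X.shiftedSwap_ne (Finset.ne_of_mem_erase hi) ν v
  rw [shiftedSwap_same] at h1
  have h4 : ∑ i, (X.shiftedSwap j ν).op i v =
      (ν • v - ∑ i, X.op i v) + ∑ i ∈ Finset.univ.erase j, X.op i v := by
    rw [← h3]; exact h1.symm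
  rw [h4, ← h2]
  abel

/-- A further entry `ν - (A_1 + ⋯ + A_p)` is appended. -/
abbrev append (X : MatTuple p) (ν : ℂ) : MatTuple (p + 1) where
  V := X.V
  op := Fin.snoc (α := fun _ => End ℂ X.V) X.op (ν • 1 - ∑ i, X.op i)

theorem append_castSucc (X : MatTuple p) (ν : ℂ) (i : Fin p) (v : X.V) :
    (X.append ν).op i.castSucc v = X.op i v := by
  change Fin.snoc (α := fun _ => End ℂ X.V) X.op (ν • 1 - ∑ i, X.op i) i.castSucc v = _
  rw [Fin.snoc_castSucc]

theorem append_last (X : MatTuple p) (ν : ℂ) (v : X.V) :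
    (X.append ν).op (Fin.last p) v = ν • v - ∑ i, X.op i v := by
  change Fin.snoc (α := fun _ => End ℂ X.V) X.op (ν • 1 - ∑ i, X.op i) (Fin.last p) v = _
  rw [Fin.snoc_last, LinearMap.sub_apply, LinearMap.sum_apply]
  rfl

/-- A scalar sum is what makes the Okubo matrix of the appended tuple a root of `(x - c)(x - c -
ν)`, as restriction demands. -/
theorem sum_append (X : MatTuple p) (ν : ℂ) (v : X.V) :
    ∑ i, (X.append ν).op i v = ν • v := by
  have h : ∑ i, (X.append ν).op i v = ∑ i : Fin p, X.op i v + (ν • v - ∑ i, X.op i v) := by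
    rw [Fin.sum_univ_castSucc]
    rw [append_last]
    exact congrArg (· + _) (Finset.sum_congr rfl fun i _ => append_castSucc X ν i v)
  rw [h]; abel

theorem Admissible.append [NeZero p] {X : MatTuple p} (h : X.Admissible) (ν : ℂ) :
    (X.append ν).Admissible := by
  refine ⟨h.nontrivial, fun W hW => h.irreducible W fun j v hv => ?_, fun i => ?_, fun i => ?_⟩
  · rw [← append_castSucc X ν]; exact hW _ v hv
  · refine Fin.lastCases (fun τ v h1 _ => ?_) (fun i τ v h1 h2 => ?_) i
    · refine h.eq_zero v fun k => ?_
      rw [← append_castSucc X ν]; exact h1 _ (Fin.castSucc_lt_last k).ne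
    · refine h.ker i τ v (fun k hk => ?_) ?_
      · rw [← append_castSucc X ν]; exact h1 _ fun e => hk (Fin.castSucc_injective p e)
      · rw [← append_castSucc X ν]; exact h2
  · refine Fin.lastCases (fun τ W h1 _ => ?_) (fun i τ W h1 h2 => ?_) i
    · refine h.eq_top W fun k v => ?_
      rw [← append_castSucc X ν]; exact h1 _ (Fin.castSucc_lt_last k).ne v
    · refine h.range i τ W (fun k hk v => ?_) fun v => ?_
      · rw [← append_castSucc X ν]; exact h1 _ (fun e => hk (Fin.castSucc_injective p e)) v
      · rw [← append_castSucc X ν]; exact h2 v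

theorem okubo_perm (X : MatTuple p) (c : ℂ) (σ : Equiv.Perm (Fin p)) :
    ((X.okubo c).toTuple.perm σ).Similar ((X.perm σ).okubo c).toTuple := by
  let e : (X.okubo c).V →ₗ[ℂ] ((X.perm σ).okubo c).V :=
    LinearMap.restrict (LinearMap.funLeft ℂ X.V σ) (fun w hw i _ => hw (σ i) trivial)
  have he : ∀ w i, (e w).1 i = w.1 (σ i) := fun w i => rfl
  have hsum : ∀ w, ∑ k, (e w).1 k = ∑ k, w.1 k := fun w => Equiv.sum_comp σ w.1
  refine Similar.of_bijective (X := (X.okubo c).toTuple.perm σ)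
    (Y := ((X.perm σ).okubo c).toTuple) e ⟨?_, ?_⟩ ?_
  · intro (w : (X.okubo c).V) (w' : (X.okubo c).V) hw
    refine okubo_ext (X := X) (c := c) fun i => ?_
    have h1 : (e w).1 (σ.symm i) = (e w').1 (σ.symm i) :=
      congrFun (congrArg Subtype.val hw) (σ.symm i)
    rwa [he, he, σ.apply_symm_apply] at h1
  · intro (w : ((X.perm σ).okubo c).V)
    refine ⟨⟨fun i => w.1 (σ.symm i), fun i _ => ?_⟩, okubo_ext (X := X.perm σ) (c := c) fun i => ?_⟩
    · have := w.2 (σ.symm i) trivial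
      change w.1 (σ.symm i) ∈ LinearMap.range (X.op (σ (σ.symm i))) at this
      rwa [σ.apply_symm_apply] at this
    · exact congrArg w.1 (σ.symm_apply_apply i)
  · intro j (w : (X.okubo c).V)
    have h : e ((X.okubo c).P (σ j) ((X.okubo c).A w)) =
        ((X.perm σ).okubo c).P j (((X.perm σ).okubo c).A (e w)) := by
      refine okubo_ext fun i => ?_
      rw [he, okubo_P_apply, okubo_P_apply, okubo_A_apply, okubo_A_apply, hsum, he]
      by_cases hi : i = j
      · subst hi
        exact (Pi.single_eq_same (M := fun _ => X.V) _ _).trans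
          (Pi.single_eq_same (M := fun _ => X.V) _ _).symm
      · exact (Pi.single_eq_of_ne (M := fun _ => X.V) (fun e => hi (σ.injective e)) _).trans
          (Pi.single_eq_of_ne (M := fun _ => X.V) hi _).symm
    exact h

/-! ### Extension -/

/-- `A - c` sees `w` only through `s = ∑ w_k`, and `A - c - ν` changes this sum into `(∑ A_k - ν)
s`. -/
theorem okubo_quad_apply (X : MatTuple p) (c ν : ℂ) (w : (X.okubo c).V) (i : Fin p) :
    ((X.okubo c).quad c (c + ν) w).1 i =
      X.op i ((∑ k, X.op k (∑ l, w.1 l)) - ν • ∑ l, w.1 l) := by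
  have h1 : ∀ (d : ℂ) (w : (X.okubo c).V) i,
      (((X.okubo c).A - d • (1 : End ℂ (X.okubo c).V)) w).1 i =
        X.op i (∑ k, w.1 k) + (c - d) • w.1 i := fun d w i => by
    have : (((X.okubo c).A - d • (1 : End ℂ (X.okubo c).V)) w).1 i =
      ((X.okubo c).A w).1 i - d • w.1 i := rfl
    rw [this, okubo_A_apply, sub_smul]; abel
  change (((X.okubo c).A - c • (1 : End ℂ (X.okubo c).V))
    (((X.okubo c).A - (c + ν) • (1 : End ℂ (X.okubo c).V)) w)).1 i = _
  rw [h1, sub_self, zero_smul, add_zero]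
  congr 1
  simp only [h1]
  rw [Finset.sum_add_distrib, ← Finset.smul_sum, sub_add_cancel_left, neg_smul, sub_eq_add_neg]

/-- The extension of the system of `X` is the system of the tuple with one more entry. -/
theorem extension_okubo [NeZero p] {X : MatTuple p} (h : X.Admissible) (c ν : ℂ) :
    ((X.okubo c).extension c (c + ν)).toTuple.Similar ((X.append ν).okubo c).toTuple := by
  let S := X.okubo c
  let T := (X.append ν).okubo c
  -- the embedding of `V` as the diagonal
  let ι : X.V →ₗ[ℂ] S.V := X.okuboMk c ∘ₗ LinearMap.pi fun _ => LinearMap.id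
  have hι : ∀ v i, (ι v).1 i = X.op i v := fun v i => rfl
  have hA : ∀ w : S.V, S.A w = ι (∑ k, w.1 k) + c • w := fun w =>
    okubo_ext fun i => X.okubo_A_apply c w i
  have hsumι : ∀ v, ∑ k, (ι v).1 k = ∑ k, X.op k v := fun v => rfl
  -- Hence `Im (A - c)(A - c - ν)` is the copy under the injective `ι` of the image of the appended
  -- entry, because the sums `∑ w_l` exhaust `V`. This identifies the new block.
  have hquad : ∀ w, S.quad c (c + ν) w = -ι ((X.append ν).op (Fin.last p) (∑ l, w.1 l)) :=
    fun w => okubo_ext fun i => by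
      rw [append_last, ← map_neg, hι, neg_sub]; exact X.okubo_quad_apply c ν w i
  have hmem : ∀ w : T.V, ι (w.1 (Fin.last p)) ∈ LinearMap.range (S.quad c (c + ν)) := fun w => by
    obtain ⟨v, hv⟩ := (X.append ν).okubo_mem c w (Fin.last p)
    obtain ⟨u, hu⟩ := h.exists_sum_eq c v
    exact ⟨-u, by rw [map_neg, hquad, neg_neg]; exact congrArg ι ((congrArg _ hu).trans hv)⟩
  let e₁ : T.V →ₗ[ℂ] S.V := LinearMap.restrict
    (LinearMap.funLeft ℂ X.V (Fin.castSucc (n := p))) (fun w hw i _ => by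
      obtain ⟨v, hv⟩ := hw i.castSucc trivial
      exact ⟨v, (append_castSucc X ν i v).symm.trans hv⟩)
  let e₂ : T.V →ₗ[ℂ] LinearMap.range (S.quad c (c + ν)) := LinearMap.codRestrict _
    (ι ∘ₗ LinearMap.proj (φ := fun _ : Fin (p + 1) => X.V) (Fin.last p) ∘ₗ Submodule.subtype _) hmem
  have he₁ : ∀ w i, (e₁ w).1 i = w.1 i.castSucc := fun w i => rfl
  have he₂ : ∀ w, (e₂ w).1 = ι (w.1 (Fin.last p)) := fun w => rfl
  have hsum : ∀ w : T.V, ∑ k, w.1 k = ∑ k, (e₁ w).1 k + w.1 (Fin.last p) := fun w =>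
    Fin.sum_univ_castSucc w.1
  have hT : ∀ (w : T.V) i, (T.A w).1 i = (X.append ν).op i (∑ k, w.1 k) + c • w.1 i :=
    fun w i => okubo_A_apply _ c w i
  let e : T.V →ₗ[ℂ] (S.extension c (c + ν)).V := LinearMap.prod e₁ e₂
  have he : Function.Bijective e := by
    constructor
    · refine (injective_iff_map_eq_zero e).mpr fun w hw => okubo_ext fun i => ?_
      have h1 : e₁ w = 0 := congrArg Prod.fst hw
      have h2 : e₂ w = 0 := congrArg Prod.snd hw
      refine Fin.lastCases ?_ (fun i => ?_) i
      · refine h.eq_zero _ fun k => ?_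
        rw [← hι, ← he₂, h2]; rfl
      · rw [← he₁, h1]; rfl
    · rintro ⟨w, _, u, rfl⟩
      let z : T.V := ⟨Fin.snoc (α := fun _ => X.V) w.1
        (-(X.append ν).op (Fin.last p) (∑ l, u.1 l)), fun i _ => by
          refine Fin.lastCases ?_ (fun i => ?_) i
          · rw [Fin.snoc_last]
            exact ⟨-∑ l, u.1 l, map_neg _ _⟩
          · rw [Fin.snoc_castSucc]
            obtain ⟨v, hv⟩ := X.okubo_mem c w i
            exact ⟨v, (append_castSucc X ν i v).trans hv⟩⟩
      have hz₁ : ∀ i : Fin p, z.1 i.castSucc = w.1 i := fun i =>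
        Fin.snoc_castSucc (α := fun _ => X.V) _ _ _
      have hz₂ : z.1 (Fin.last p) = -(X.append ν).op (Fin.last p) (∑ l, u.1 l) :=
        Fin.snoc_last (α := fun _ => X.V) _ _
      refine ⟨z, Prod.ext (okubo_ext hz₁) (Subtype.ext ?_)⟩
      change ι (z.1 (Fin.last p)) = _
      rw [hz₂, map_neg]; exact (hquad u).symm
  refine Similar.symm (OkuboSystem.toTuple_similar (S := T) (T := S.extension c (c + ν))
    e he ?_ ?_)
  · intro j w
    refine Fin.lastCases ?_ (fun j => ?_) j
    · have hr : (S.extension c (c + ν)).P (Fin.last p) (e w) = (0, e₂ w) := by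
        change OkuboSystem.extP S.P (Fin.last p) (e₁ w, e₂ w) = _
        simp [OkuboSystem.extP]
      rw [hr]
      refine Prod.ext (okubo_ext fun i => ?_) (Subtype.ext (congrArg ι ?_))
      · exact Pi.single_eq_of_ne (M := fun _ => X.V) (Fin.castSucc_lt_last i).ne _
      · exact Pi.single_eq_same (M := fun _ => X.V) _ _
    · have hr : (S.extension c (c + ν)).P j.castSucc (e w) = (S.P j (e₁ w), 0) := by
        change OkuboSystem.extP S.P j.castSucc (e₁ w, e₂ w) = _
        simp [OkuboSystem.extP]
      rw [hr]
      refine Prod.ext (okubo_ext fun i => ?_) (Subtype.ext ?_)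
      · change Pi.single (M := fun _ => X.V) j.castSucc (w.1 j.castSucc) i.castSucc =
          Pi.single (M := fun _ => X.V) j (w.1 j.castSucc) i
        by_cases hi : i = j
        · subst hi; rw [Pi.single_eq_same, Pi.single_eq_same]
        · rw [Pi.single_eq_of_ne hi, Pi.single_eq_of_ne fun e => hi (Fin.castSucc_injective p e)]
      · refine (congrArg ι ?_).trans (map_zero ι)
        exact Pi.single_eq_of_ne (M := fun _ => X.V) (Fin.castSucc_lt_last j).ne' _
  · intro w
    have hr : (S.extension c (c + ν)).A (e w) = (S.A (e₁ w) + (e₂ w).1,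
        -((S.quad c (c + ν)).rangeRestrict (e₁ w)) +
          (-(S.A.restrict (S.quad_range c (c + ν)) (e₂ w)) + (c + (c + ν)) • e₂ w)) := rfl
    rw [hr]
    refine Prod.ext ?_ (Subtype.ext ?_)
    · change e₁ (T.A w) = S.A (e₁ w) + (e₂ w).1
      refine okubo_ext fun i => ?_
      rw [he₁, hT, append_castSucc, hsum, map_add, hA, he₂, ← he₁, ← hι, ← hι]
      exact add_right_comm _ _ _
    · change ι ((T.A w).1 (Fin.last p)) = -(S.quad c (c + ν) (e₁ w)) +
          (-(S.A (e₂ w).1) + (c + (c + ν)) • (e₂ w).1)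
      rw [hT, hquad, hA, he₂, hsumι, map_add, hsum, map_add, map_add, neg_neg, add_assoc]
      congr 1
      rw [append_last, map_sub, map_smul, map_smul]
      module

end MatTuple

namespace MatTuple

variable {p : ℕ}

/-! ### Restriction -/

/-- The last entry is dropped. -/
abbrev init (Y : MatTuple (p + 1)) : MatTuple p where
  V := Y.V
  op := fun i => Y.op i.castSucc

/-- The matrix couples components only through their sum, so deleting the last block row and column
has the same effect as forgetting the last entry. -/
theorem restriction_okubo (Y : MatTuple (p + 1)) (c : ℂ) :
    (Y.okubo c).restriction.toTuple.Similar (Y.init.okubo c).toTuple := by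
  have hlast : ∀ w : LinearMap.ker ((Y.okubo c).P (Fin.last p)), w.1.1 (Fin.last p) = 0 :=
    fun w => by
      have := congrFun (congrArg Subtype.val w.2) (Fin.last p)
      rw [okubo_P_apply, Pi.single_eq_same] at this
      exact this
  let e : LinearMap.ker ((Y.okubo c).P (Fin.last p)) →ₗ[ℂ] (Y.init.okubo c).V :=
    LinearMap.codRestrict _ (LinearMap.funLeft ℂ Y.V (Fin.castSucc (n := p)) ∘ₗ
      Submodule.subtype _ ∘ₗ Submodule.subtype _) (fun w i _ => w.1.2 i.castSucc trivial)
  have he : ∀ w i, (e w).1 i = w.1.1 i.castSucc := fun w i => rfl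
  have hsum : ∀ w, ∑ k, w.1.1 k = ∑ k, (e w).1 k := fun w => by
    rw [Fin.sum_univ_castSucc, hlast, add_zero]; rfl
  have hb : Function.Bijective e := by
    constructor
    · refine (injective_iff_map_eq_zero e).mpr fun w hw => Subtype.ext (okubo_ext fun i => ?_)
      refine Fin.lastCases ?_ (fun i => ?_) i
      · rw [hlast]; rfl
      · rw [← he, hw]; rfl
    · intro w
      let z : (Y.okubo c).V := ⟨Fin.snoc (α := fun _ => Y.V) w.1 0, fun i _ => by
        refine Fin.lastCases ?_ (fun i => ?_) i
        · rw [Fin.snoc_last]; exact zero_mem _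
        · rw [Fin.snoc_castSucc]; exact w.2 i trivial⟩
      have hz : z ∈ LinearMap.ker ((Y.okubo c).P (Fin.last p)) := by
        refine okubo_ext fun i => ?_
        have h0 : z.1 (Fin.last p) = 0 := Fin.snoc_last (α := fun _ => Y.V) _ _
        rw [okubo_P_apply, h0, Pi.single_zero]; rfl
      exact ⟨⟨z, hz⟩, okubo_ext fun i => Fin.snoc_castSucc (α := fun _ => Y.V) _ _ _⟩
  refine OkuboSystem.toTuple_similar (S := (Y.okubo c).restriction) (T := Y.init.okubo c) e hb ?_ ?_
  · intro j w
    refine okubo_ext fun i => ?_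
    change Pi.single (M := fun _ => Y.V) j.castSucc (w.1.1 j.castSucc) i.castSucc =
      Pi.single (M := fun _ => Y.V) j (w.1.1 j.castSucc) i
    by_cases hi : i = j
    · subst hi; rw [Pi.single_eq_same, Pi.single_eq_same]
    · rw [Pi.single_eq_of_ne hi, Pi.single_eq_of_ne fun e => hi (Fin.castSucc_injective p e)]
  · intro (w : LinearMap.ker ((Y.okubo c).P (Fin.last p)))
    have h : e ((Y.okubo c).initProj ((Y.okubo c).A w.1)) = (Y.init.okubo c).A (e w) := by
      refine okubo_ext fun i => ?_
      have h1 : (e ((Y.okubo c).initProj ((Y.okubo c).A w.1))).1 i =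
          ((Y.okubo c).A w.1).1 i.castSucc - Pi.single (M := fun _ => Y.V) (Fin.last p)
            (((Y.okubo c).A w.1).1 (Fin.last p)) i.castSucc := rfl
      rw [h1, Pi.single_eq_of_ne (Fin.castSucc_lt_last i).ne, sub_zero, okubo_A_apply,
        okubo_A_apply, hsum]
      rfl
    exact h

/-- Take `μ₁ = c`, `μ₂ = c + ν`. The last diagonal block acts on `Im A_{p+1}` as `A_{p+1} + c`; an
eigenvector `x` for `2c + ν` has `A_{p+1} x = (c + ν) x`, so the other entries sum to `-c` on `x`,
which `hinit` excludes. -/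
theorem Admissible.restrictable_okubo {Y : MatTuple (p + 1)} (h : Y.Admissible) {c ν : ℂ}
    (hν : ∀ v, ∑ i, Y.op i v = ν • v) (hc : c ≠ 0) (hcν : c + ν ≠ 0)
    (hinit : ∀ v, (∑ i, Y.init.op i v) + c • v = 0 → v = 0) : (Y.okubo c).Restrictable := by
  have hinj : ∀ w, (Y.okubo c).A w = 0 → w = 0 := Y.okubo_A_injective hc fun v hv => by
    rw [hν, ← add_smul, add_comm ν] at hv
    exact (smul_eq_zero.mp hv).resolve_left hcν
  refine ⟨(h.okubo_toTuple hinj).irreducible, c, c + ν, ?_, h.okubo_A_ne_smul c, ?_⟩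
  · refine LinearMap.ext fun w => okubo_ext fun i => ?_
    rw [okubo_quad_apply, hν, sub_self, map_zero]; rfl
  · intro hev
    obtain ⟨x, hx⟩ := hev.exists_hasEigenvector
    obtain ⟨w, hw⟩ := x.2
    obtain ⟨v, hv⟩ := Y.okubo_mem c w (Fin.last p)
    rw [Y.okubo_P_eq_single c _ hv] at hw
    have h1 : (Y.okubo c).P (Fin.last p) ((Y.okubo c).A x.1) = (c + (c + ν)) • x.1 :=
      congrArg Subtype.val hx.apply_eq_smul
    rw [← hw] at h1
    have h2 : Y.op (Fin.last p) (Y.op (Fin.last p) v) + c • Y.op (Fin.last p) v =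
        (c + (c + ν)) • Y.op (Fin.last p) v := by
      have := congrFun (congrArg Subtype.val h1) (Fin.last p)
      rw [okubo_P_apply, Pi.single_eq_same, okubo_A_single_same, map_add, map_smul] at this
      exact this.trans (congrArg _ (okuboSingle_same Y c _ v))
    have h3 : Y.op (Fin.last p) v = 0 := by
      apply hinit
      have h4 := hν (Y.op (Fin.last p) v)
      rw [Fin.sum_univ_castSucc, eq_sub_of_add_eq h2] at h4
      rw [eq_sub_of_add_eq h4]
      module
    refine hx.2 (Subtype.ext ?_)
    rw [← hw]
    refine okubo_ext fun k => ?_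
    by_cases hk : k = Fin.last p
    · subst hk; rw [okuboSingle_same, h3]; rfl
    · rw [okuboSingle_ne Y c hk]; rfl

theorem init_append_swap (X : MatTuple p) (j : Fin p) (ν : ℂ) :
    ((X.append ν).perm (Equiv.swap j.castSucc (Fin.last p))).init.Similar (X.shiftedSwap j ν) := by
  refine ⟨LinearEquiv.refl ℂ X.V, fun i (v : X.V) => ?_⟩
  change (X.append ν).op (Equiv.swap j.castSucc (Fin.last p) i.castSucc) v =
    (X.shiftedSwap j ν).op i v
  by_cases hi : i = j
  · subst hi
    rw [Equiv.swap_apply_left, append_last, shiftedSwap_same]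
  · rw [Equiv.swap_apply_of_ne_of_ne (fun e => hi (Fin.castSucc_injective p e))
      (Fin.castSucc_lt_last i).ne, append_castSucc, shiftedSwap_ne X hi]

/-- Extension, generic Euler transformation and restriction realize
`mc_d ∘ T ∘ mc_{-c}`, where `T` replaces the `j`-th entry by `ν - (A_1 + ⋯ + A_p)`. -/
theorem Admissible.yokoyamaStep [NeZero p] {X : MatTuple p} (h : X.Admissible) (j : Fin p)
    {ν c d : ℂ} (hc : c ≠ 0) (hcν : c + ν ≠ 0)
    (hXc : ∀ v, (∑ i, X.op i v) + c • v = 0 → v = 0) (hd : d ≠ 0) (hdν : d + ν ≠ 0)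
    (hXd : ∀ v, (∑ i, (X.shiftedSwap j ν).op i v) + d • v = 0 → v = 0) :
    YokoyamaStep (X.mc c) ((X.shiftedSwap j ν).mc d) := by
  have hsum : ∀ e : ℂ, e + ν ≠ 0 → ∀ v, (∑ i, (X.append ν).op i v) + e • v = 0 → v = 0 :=
    fun e he v hv => by
      rw [sum_append, ← add_smul, add_comm ν] at hv
      exact (smul_eq_zero.mp hv).resolve_left he
  have hXadm := h.append ν
  have hinjc := (X.append ν).okubo_A_injective hc (hsum c hcν)
  have hinjd := (X.append ν).okubo_A_injective hd (hsum d hdν)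
  -- The parameters are `ε = d - c`, `ρ₁ = c`, `ρ₂ = c + ν`. The intermediate systems are those of
  -- the appended tuple at parameters `c` and `d`.
  refine ⟨j, d - c, c, c + ν, ((X.append ν).okubo c).toTuple, ((X.append ν).okubo d).toTuple,
    ⟨hc, hcν, X.okubo c, X.mc_similar_okubo hc hXc,
      OkuboSystem.rankCondition_of_admissible (h.okubo_toTuple (X.okubo_A_injective hc hXc)),
      extension_okubo h c ν⟩,
    ⟨(X.append ν).okubo c, Similar.refl _,
      OkuboSystem.rankCondition_of_admissible (hXadm.okubo_toTuple hinjc), ?_, ?_⟩, ?_⟩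
  · intro hev
    obtain ⟨w, hw⟩ := hev.exists_hasEigenvector
    refine hw.2 (hinjd w (okubo_ext fun i => ?_))
    have h1 := congrFun (congrArg Subtype.val hw.apply_eq_smul) i
    rw [okubo_A_apply] at h1
    refine (okubo_A_apply _ d w i).trans ?_
    have h2 : (X.append ν).op i (∑ k, w.1 k) + c • w.1 i = (-(d - c)) • w.1 i := h1
    rw [eq_sub_of_add_eq h2]
    change _ = (0 : X.V)
    module
  · have := (X.append ν).okubo_euler c (d - c)
    rwa [add_sub_cancel] at this
  · set σ := Equiv.swap j.castSucc (Fin.last p)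
    let Y := (X.append ν).perm σ
    have hY : Y.Admissible := hXadm.perm σ
    have hYν : ∀ v, ∑ i, Y.op i v = ν • v := fun v =>
      (Equiv.sum_comp σ fun i => (X.append ν).op i v).trans (X.sum_append ν v)
    obtain ⟨g, hg⟩ := X.init_append_swap j ν
    have hYinit : ∀ v, (∑ i, Y.init.op i v) + d • v = 0 → v = 0 := fun v hv => by
      rw [← g.map_eq_zero_iff]
      apply hXd
      have := congrArg g hv
      rw [map_add, map_sum, map_smul, map_zero] at this
      rw [← this]
      congr 1
      exact Finset.sum_congr rfl fun i _ => (hg i v).symm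
    exact ⟨Y.okubo d, okubo_perm _ d σ, hY.restrictable_okubo hYν hd hdν hYinit,
      (Y.restriction_okubo d).trans ((Y.init.mc_similar_okubo hd hYinit).symm.trans
        (Similar.mc ⟨g, hg⟩ d))⟩

end MatTuple

namespace MatTuple

variable {p : ℕ}

/-! ### Generation by the operations `shiftedSwap` -/

theorem shiftedSwap_shiftedSwap_same (X : MatTuple p) (j : Fin p) (ν ν' : ℂ) (v : X.V) :
    ((X.shiftedSwap j ν).shiftedSwap j ν').op j v = X.op j v + (ν' - ν) • v := by
  rw [shiftedSwap_same, sum_shiftedSwap, sub_smul]; abel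

theorem shiftedSwap_shiftedSwap_ne (X : MatTuple p) {j i : Fin p} (h : i ≠ j) (ν ν' : ℂ)
    (v : X.V) : ((X.shiftedSwap j ν).shiftedSwap j ν').op i v = X.op i v := by
  rw [shiftedSwap_ne _ h, shiftedSwap_ne _ h]

theorem shiftedSwap_shiftedSwap_similar (X : MatTuple p) (j : Fin p) (ν : ℂ) :
    ((X.shiftedSwap j ν).shiftedSwap j ν).Similar X := by
  refine ⟨LinearEquiv.refl ℂ X.V, fun i v => ?_⟩
  change ((X.shiftedSwap j ν).shiftedSwap j ν).op i v = X.op i v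
  by_cases hi : i = j
  · subst hi; rw [shiftedSwap_shiftedSwap_same, sub_self, zero_smul, add_zero]
  · exact shiftedSwap_shiftedSwap_ne X hi ν ν v

theorem IsIrreducible.shiftedSwap {X : MatTuple p} (h : X.IsIrreducible) (j : Fin p) (ν : ℂ) :
    (X.shiftedSwap j ν).IsIrreducible := by
  intro W hW
  refine h W fun i v hv => ?_
  have hi := hW i v hv
  by_cases hij : i = j
  · subst hij
    have h1 := sum_shiftedSwap X i ν v
    rw [eq_sub_iff_add_eq, ← eq_sub_iff_add_eq'] at h1
    rw [h1]
    exact sub_mem (Submodule.smul_mem _ _ hv) (Submodule.sum_mem _ fun k _ => hW k v hv)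
  · rwa [shiftedSwap_ne X hij] at hi

/-- Two swaps at `j`, with shifts `0` and `μ_j`, add `μ_j` to the `j`-th entry; the entries are
treated one at a time. -/
theorem addition_of_shiftedSwap {M : MatTuple p → Prop} (hs : ∀ X Y, X.Similar Y → M X → M Y)
    (hq : ∀ X j ν, M X → M (shiftedSwap X j ν)) (X : MatTuple p) (μ : Fin p → ℂ) (hX : M X) :
    M (X.addition μ) := by
  have key : ∀ s : Finset (Fin p), M (X.addition (s.piecewise μ 0)) := by
    intro s
    induction s using Finset.induction_on with
    | empty =>
      refine hs X _ ⟨LinearEquiv.refl ℂ X.V, fun i v => ?_⟩ hX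
      change X.op i v = X.op i v + (0 : ℂ) • v
      rw [zero_smul, add_zero]
    | insert j s hj ih =>
      refine hs (((X.addition (s.piecewise μ 0)).shiftedSwap j 0).shiftedSwap j (μ j)) _
        ⟨LinearEquiv.refl ℂ X.V, fun i (v : X.V) => ?_⟩ (hq _ j (μ j) (hq _ j 0 ih))
      have hadd : ∀ (f : Fin p → ℂ) i (v : X.V), (X.addition f).op i v = X.op i v + f i • v :=
        fun f i v => rfl
      refine Eq.trans ?_ (hadd _ i v).symm
      by_cases hi : i = j
      · subst hi
        refine (shiftedSwap_shiftedSwap_same (X.addition (s.piecewise μ 0)) i 0 (μ i) v).trans ?_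
        refine (congrArg (· + (μ i - 0) • v) (hadd _ i v)).trans ?_
        rw [Finset.piecewise_eq_of_notMem _ _ _ hj, Finset.piecewise_insert_self, sub_zero,
          Pi.zero_apply, zero_smul, add_zero]
      · refine (shiftedSwap_shiftedSwap_ne (X.addition (s.piecewise μ 0)) hi 0 (μ j) v).trans ?_
        have hpw : (insert j s).piecewise μ 0 i = s.piecewise μ 0 i := by
          rw [Finset.piecewise_insert, Function.update_of_ne hi]
        rw [hpw]
        exact hadd _ i v
  have := key Finset.univ
  rwa [Finset.piecewise_univ] at this

/-- With `-(A_1 + ⋯ + A_p)` regarded as an entry at `∞`, the swap at `j` with shift `0` is the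
transposition `(j ∞)`, and `(x y) = (x ∞)(y ∞)(x ∞)`. -/
theorem perm_of_shiftedSwap {M : MatTuple p → Prop} (hs : ∀ X Y, X.Similar Y → M X → M Y)
    (hq : ∀ X j ν, M X → M (shiftedSwap X j ν)) (σ : Equiv.Perm (Fin p)) (X : MatTuple p)
    (hX : M X) : M (X.perm σ) := by
  induction σ using Equiv.Perm.swap_induction_on generalizing X with
  | one => exact hX
  | swap_mul f x y hxy ih =>
    refine ih (X.perm (Equiv.swap x y)) (hs
      (((X.shiftedSwap x 0).shiftedSwap y 0).shiftedSwap x 0) _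
      ⟨LinearEquiv.refl ℂ X.V, fun i (v : X.V) => ?_⟩ (hq _ x 0 (hq _ y 0 (hq _ x 0 hX))))
    change (((X.shiftedSwap x 0).shiftedSwap y 0).shiftedSwap x 0).op i v =
      X.op (Equiv.swap x y i) v
    by_cases hx : i = x
    · subst hx
      rw [Equiv.swap_apply_left, shiftedSwap_same, sum_shiftedSwap, shiftedSwap_ne X hxy.symm,
        zero_smul, zero_sub, zero_sub, neg_neg]
    · rw [shiftedSwap_ne _ hx]
      by_cases hy : i = y
      · subst hy
        rw [Equiv.swap_apply_right, shiftedSwap_same, sum_shiftedSwap, zero_smul, zero_sub,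
          zero_sub, neg_neg]
      · rw [shiftedSwap_ne _ hy, shiftedSwap_ne _ hx, Equiv.swap_apply_of_ne_of_ne hx hy]

theorem inftySwap_similar (X : MatTuple p) (j : Fin p) :
    (X.shiftedSwap j 0).Similar (X.inftySwap j) := by
  refine ⟨LinearEquiv.refl ℂ X.V, fun i v => ?_⟩
  change (X.shiftedSwap j 0).op i v = Function.update X.op j (-∑ i, X.op i) i v
  change Function.update X.op j ((0 : ℂ) • 1 - ∑ i, X.op i) i v = _
  rw [zero_smul, zero_sub]

/-! ### Reachability -/

theorem YokoyamaReachable.similar {C X Y : MatTuple p} (h : YokoyamaReachable C X)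
    (hXY : X.Similar Y) : YokoyamaReachable C Y := by
  obtain ⟨Z, hZ, hZX⟩ := h
  exact ⟨Z, hZ, hZX.trans hXY⟩

theorem YokoyamaReachable.step {C X Y : MatTuple p} (h : YokoyamaReachable C X)
    (hXY : YokoyamaStep X Y) : YokoyamaReachable C Y := by
  obtain ⟨Z, hZ, hZX⟩ := h
  obtain ⟨j, ε, ρ₁, ρ₂, X₁, X₂, ⟨h₁, h₂, S, hS, hr⟩, h'⟩ := hXY
  exact ⟨Y, hZ.tail ⟨j, ε, ρ₁, ρ₂, X₁, X₂, ⟨h₁, h₂, S, hZX.trans hS, hr⟩, h'⟩, Similar.refl Y⟩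

/-- For all but finitely many `c`, the middle convolution `mc_c(X)` is reachable from `C`. -/
def GenericallyReachable (C X : MatTuple p) : Prop :=
  {c : ℂ | ¬ YokoyamaReachable C (X.mc c)}.Finite

theorem GenericallyReachable.similar {C X Y : MatTuple p} (h : GenericallyReachable C X)
    (hXY : X.Similar Y) : GenericallyReachable C Y :=
  h.subset fun c hc hX => hc (hX.similar (hXY.mc c))

theorem finite_not_injective_sum (X : MatTuple p) :
    {c : ℂ | ¬ ∀ v, (∑ i, X.op i v) + c • v = 0 → v = 0}.Finite := by
  have := finite_not_injective (∑ i, X.op i)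
  simpa only [LinearMap.sum_apply] using this

/-- Source and target parameters of a step are independent, so one good `c` yields all but finitely
many `d`. -/
theorem Admissible.genericallyReachable_of_reachable [NeZero p] {C X : MatTuple p}
    (h : X.Admissible) (j : Fin p) {ν c : ℂ} (hc : c ≠ 0) (hcν : c + ν ≠ 0)
    (hXc : ∀ v, (∑ i, X.op i v) + c • v = 0 → v = 0) (hr : YokoyamaReachable C (X.mc c)) :
    GenericallyReachable C (X.shiftedSwap j ν) := by
  refine ((Set.toFinite {0, -ν}).union (X.shiftedSwap j ν).finite_not_injective_sum).subset
    fun d hd => ?_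
  by_contra hn
  rw [Set.mem_union, not_or, Set.mem_insert_iff, not_or, Set.mem_singleton_iff,
    Set.mem_ofPred_eq, not_not] at hn
  exact hd (hr.step (h.yokoyamaStep j hc hcν hXc hn.1.1
    (fun e => hn.1.2 (eq_neg_of_add_eq_zero_left e)) hn.2))

/-- A generic parameter. -/
theorem GenericallyReachable.exists_parameter {C X : MatTuple p} (hX : GenericallyReachable C X)
    (ν : ℂ) : ∃ c : ℂ, c ≠ 0 ∧ c + ν ≠ 0 ∧
      (∀ v, (∑ i, X.op i v) + c • v = 0 → v = 0) ∧ YokoyamaReachable C (X.mc c) := by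
  obtain ⟨c, hc⟩ := (((Set.toFinite {0, -ν}).union X.finite_not_injective_sum).union hX).exists_notMem
  rw [Set.mem_union, not_or, Set.mem_union, not_or, Set.mem_insert_iff, not_or,
    Set.mem_singleton_iff, Set.mem_ofPred_eq, not_not, Set.mem_ofPred_eq, not_not] at hc
  exact ⟨c, hc.1.1.1, fun e => hc.1.1.2 (eq_neg_of_add_eq_zero_left e), hc.1.2, hc.2⟩

theorem GenericallyReachable.shiftedSwap [NeZero p] {C X : MatTuple p}
    (hX : GenericallyReachable C X) (h : X.Admissible) (j : Fin p) (ν : ℂ) :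
    GenericallyReachable C (X.shiftedSwap j ν) := by
  obtain ⟨c, hc, hcν, hXc, hr⟩ := hX.exists_parameter ν
  exact h.genericallyReachable_of_reachable j hc hcν hXc hr

/-- For generic `c`, `mc_{c-b}(mc_b(X)) ∼ mc_c(X)`: the exceptional sets agree up to a translation
and finitely many points. -/
theorem Admissible.genericallyReachable_mc_iff [NeZero p] {C X : MatTuple p} (h : X.Admissible)
    (b : ℂ) : GenericallyReachable C (X.mc b) ↔ GenericallyReachable C X := by
  have hF := (Set.finite_singleton (0 : ℂ)).union X.finite_not_injective_sum
  have key : ∀ c, c ∉ ({0} ∪ {c : ℂ | ¬ ∀ v, (∑ i, X.op i v) + c • v = 0 → v = 0}) →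
      ((X.mc b).mc (c - b)).Similar (X.mc c) := fun c hc => by
    rw [Set.mem_union, not_or, Set.mem_singleton_iff, Set.mem_ofPred_eq, not_not] at hc
    have := h.mc_mc (c := b) (d := c - b) (by rw [add_sub_cancel]; exact hc.1)
      (by rw [add_sub_cancel]; exact hc.2)
    rwa [add_sub_cancel] at this
  constructor
  · intro hX
    refine (hF.union (hX.image (· + b))).subset fun c hc => ?_
    by_contra hn
    rw [Set.mem_union, not_or] at hn
    refine hn.2 ⟨c - b, fun hr => hc (hr.similar (key c hn.1)), sub_add_cancel c b⟩
  · intro hX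
    refine ((hF.union hX).image (· - b)).subset fun d hd => ?_
    refine ⟨d + b, ?_, add_sub_cancel_right d b⟩
    by_contra hn
    rw [Set.mem_union, not_or, Set.mem_ofPred_eq (p := fun c => ¬ YokoyamaReachable C (X.mc c)),
      not_not] at hn
    have := (key (d + b) hn.1).symm
    rw [add_sub_cancel_right] at this
    exact hd (hn.2.similar this)

/-! ### One-dimensional tuples -/

/-- The tuple of scalars on `ℂ`. -/
abbrev scalar (a : Fin p → ℂ) : MatTuple p where
  V := ℂ
  op := fun j => a j • 1

theorem scalar_op (a : Fin p → ℂ) (j : Fin p) (v : ℂ) : (scalar a).op j v = a j * v := rfl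

theorem exists_similar_scalar {X : MatTuple p} (h : finrank ℂ X.V = 1) :
    ∃ a, X.Similar (scalar a) := by
  let g : X.V ≃ₗ[ℂ] ℂ := LinearEquiv.ofFinrankEq X.V ℂ (by rw [h, finrank_self])
  refine ⟨fun j => g (X.op j (g.symm 1)), g, fun j v => ?_⟩
  have hv : v = g v • g.symm 1 := g.injective (by simp)
  rw [scalar_op]
  conv_lhs => rw [hv, map_smul, map_smul, smul_eq_mul, mul_comm]

theorem scalar_admissible {a : Fin p → ℂ} {i j : Fin p} (hij : i ≠ j) (hi : a i ≠ 0)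
    (hj : a j ≠ 0) : (scalar a).Admissible := by
  have hk : ∀ k, ∃ l, l ≠ k ∧ a l ≠ 0 := fun k => by
    by_cases h : i = k
    · exact ⟨j, fun e => hij (h.trans e.symm), hj⟩
    · exact ⟨i, h, hi⟩
  refine ⟨inferInstanceAs (Nontrivial ℂ), fun W _ => ?_, fun k τ v h1 _ => ?_,
    fun k τ W h1 _ => ?_⟩
  · exact eq_bot_or_eq_top (α := Submodule ℂ ℂ) W
  · obtain ⟨l, hl, hl0⟩ := hk k
    exact (mul_eq_zero.mp (h1 l hl)).resolve_left hl0
  · obtain ⟨l, hl, hl0⟩ := hk k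
    refine Submodule.eq_top_iff'.mpr fun v => ?_
    have := h1 l hl ((a l)⁻¹ * v)
    rwa [scalar_op, mul_inv_cancel_left₀ hl0] at this

theorem exists_single_of_not_admissible [NeZero p] {a : Fin p → ℂ} (h : ¬ (scalar a).Admissible) :
    ∃ k b, a = Pi.single k b := by
  by_cases h0 : a = 0
  · exact ⟨0, 0, by rw [h0, Pi.single_zero]⟩
  · obtain ⟨k, hk⟩ := Function.ne_iff.mp h0
    refine ⟨k, a k, funext fun i => ?_⟩
    by_cases hi : i = k
    · subst hi; rw [Pi.single_eq_same]
    · rw [Pi.single_eq_of_ne hi]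
      by_contra hi0
      exact h (scalar_admissible hi hi0 hk)

theorem Admissible.exists_scalar_ne_zero [NeZero p] {a : Fin p → ℂ} (h : (scalar a).Admissible) :
    ∃ i j, i ≠ j ∧ a i ≠ 0 ∧ a j ≠ 0 := by
  by_contra hn
  push Not at hn
  by_cases h0 : a = 0
  · exact one_ne_zero (h.eq_zero (1 : ℂ) fun k => by rw [scalar_op, h0, Pi.zero_apply, zero_mul])
  · obtain ⟨k, hk⟩ := Function.ne_iff.mp h0
    refine one_ne_zero (h.ker k (a k) (1 : ℂ) (fun i hi => ?_) rfl)
    rw [scalar_op, hn k i hi.symm hk, zero_mul]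

/-- In dimension one the shift can be chosen to give the `j`-th entry any value `t`. -/
theorem scalar_shiftedSwap (a : Fin p → ℂ) (j : Fin p) (t : ℂ) :
    ((scalar a).shiftedSwap j (t + ∑ i, a i)).Similar (scalar (Function.update a j t)) := by
  refine ⟨LinearEquiv.refl ℂ ℂ, fun i (v : ℂ) => ?_⟩
  change ((scalar a).shiftedSwap j (t + ∑ i, a i)).op i v = Function.update a j t i * v
  by_cases hi : i = j
  · subst hi
    rw [shiftedSwap_same, Function.update_self]
    have hs : ∑ k, (scalar a).op k v = (∑ k, a k) * v := (Finset.sum_mul _ _ _).symm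
    rw [hs, smul_eq_mul]; ring
  · rw [shiftedSwap_ne _ hi, Function.update_of_ne hi, scalar_op]

/-- Entries are changed one at a time; those at `i` and `j` remain nonzero throughout, which keeps
every intermediate tuple admissible. -/
theorem genericallyReachable_scalar [NeZero p] {C : MatTuple p} {a b : Fin p → ℂ} {i j : Fin p}
    (hij : i ≠ j) (hai : a i ≠ 0) (haj : a j ≠ 0) (hbi : b i ≠ 0) (hbj : b j ≠ 0)
    (h : GenericallyReachable C (scalar a)) : GenericallyReachable C (scalar b) := by
  have key : ∀ s : Finset (Fin p), GenericallyReachable C (scalar (s.piecewise b a)) := by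
    intro s
    induction s using Finset.induction_on with
    | empty => rwa [Finset.piecewise_empty]
    | insert k s hk ih =>
      rw [Finset.piecewise_insert]
      have hne : ∀ l, a l ≠ 0 → b l ≠ 0 → s.piecewise b a l ≠ 0 := fun l h1 h2 => by
        by_cases hl : l ∈ s
        · rwa [Finset.piecewise_eq_of_mem _ _ _ hl]
        · rwa [Finset.piecewise_eq_of_notMem _ _ _ hl]
      exact (ih.shiftedSwap (scalar_admissible hij (hne i hai hbi) (hne j haj hbj)) k _).similar
        (scalar_shiftedSwap _ k (b k))
  have := key Finset.univ
  rwa [Finset.piecewise_univ] at this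

/-- All one-dimensional admissible tuples are connected with each other. -/
theorem GenericallyReachable.of_finrank_eq_one [NeZero p] {C X Y : MatTuple p}
    (h : GenericallyReachable C X) (hX : X.Admissible) (hX1 : finrank ℂ X.V = 1)
    (hY : Y.Admissible) (hY1 : finrank ℂ Y.V = 1) : GenericallyReachable C Y := by
  obtain ⟨a, ha⟩ := exists_similar_scalar hX1
  obtain ⟨b, hb⟩ := exists_similar_scalar hY1
  obtain ⟨i, j, hij, hi, hj⟩ := (hX.of_similar ha).exists_scalar_ne_zero
  obtain ⟨i', j', hij', hi', hj'⟩ := (hY.of_similar hb).exists_scalar_ne_zero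
  -- The two tuples may have disjoint sets of nonzero entries; the all-ones tuple connects them.
  have h1 : GenericallyReachable C (scalar (1 : Fin p → ℂ)) :=
    genericallyReachable_scalar hij hi hj one_ne_zero one_ne_zero (h.similar ha)
  exact (genericallyReachable_scalar hij' one_ne_zero one_ne_zero hi' hj' h1).similar hb.symm

/-- If `b = 0`, `𝓚` is everything; otherwise `𝓚 = {u_k = 0}`, and for `b + c = 0` the constant
vectors in `𝓛_c` supply the missing direction. -/
theorem subsingleton_mc_scalar {k : Fin p} {b c : ℂ} (h : b = 0 ∨ b + c = 0) :
    Subsingleton ((scalar (Pi.single k b)).mc c).V := by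
  have htop : (scalar (Pi.single k b)).convK ⊔ (scalar (Pi.single k b)).convL c = ⊤ := by
    refine Submodule.eq_top_iff'.mpr fun (u : Fin p → ℂ) => ?_
    by_cases hb : b = 0
    · refine Submodule.mem_sup_left (mem_convK.mpr fun i => ?_)
      rw [scalar_op, hb, Pi.single_zero]; exact zero_mul _
    · refine Submodule.mem_sup.mpr ⟨fun i => u i - u k, mem_convK.mpr fun i => ?_, fun _ => u k,
        mem_convL.mpr fun i => ?_, funext fun i => sub_add_cancel (u i) (u k)⟩
      · rw [scalar_op]
        by_cases hi : i = k
        · subst hi; rw [sub_self, mul_zero]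
        · rw [Pi.single_eq_of_ne hi, zero_mul]
      · have hs : ∑ i, (scalar (Pi.single k b)).op i (u k) =
            (∑ i, Pi.single (M := fun _ => ℂ) k b i) * u k := (Finset.sum_mul _ _ _).symm
        rw [hs, Finset.sum_pi_single', if_pos (Finset.mem_univ k), smul_eq_mul,
          ← add_mul, h.resolve_left hb, zero_mul]
  exact Submodule.Quotient.subsingleton_iff.mpr htop

theorem mc_scalar_similar {k : Fin p} {b c : ℂ} (hb : b ≠ 0) (hbc : b + c ≠ 0) :
    ((scalar (Pi.single k b)).mc c).Similar (scalar (Pi.single k (b + c))) := by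
  have hsum : ∀ u : Fin p → ℂ, ∑ i, (scalar (Pi.single k b)).op i (u i) = b * u k := fun u => by
    rw [Finset.sum_eq_single k]
    · rw [scalar_op, Pi.single_eq_same]
    · intro i _ hi; rw [scalar_op, Pi.single_eq_of_ne hi, zero_mul]
    · simp
  refine mc_similar_of_surjective _ _ c
    (LinearMap.proj (φ := fun _ : Fin p => ℂ) (R := ℂ) k) (fun v => ⟨fun _ => v, rfl⟩)
    (fun (u : Fin p → ℂ) => ?_) (fun j (u : Fin p → ℂ) => ?_)
  · change u k = 0 ↔ _
    constructor
    · intro hu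
      refine Submodule.mem_sup_left (mem_convK.mpr fun i => ?_)
      rw [scalar_op]
      by_cases hi : i = k
      · subst hi; rw [hu, mul_zero]
      · rw [Pi.single_eq_of_ne hi, zero_mul]
    · intro hu
      obtain ⟨x, hx, y, hy, rfl⟩ := Submodule.mem_sup.mp hu
      have h1 := mem_convK.mp hx k
      rw [scalar_op, Pi.single_eq_same] at h1
      have h2 := mem_convL.mp hy k
      rw [hsum, smul_eq_mul, ← add_mul] at h2
      rw [Pi.add_apply, (mul_eq_zero.mp h1).resolve_left hb, (mul_eq_zero.mp h2).resolve_left hbc,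
        add_zero]
  · change (scalar (Pi.single k b)).conv c j u k = Pi.single (M := fun _ => ℂ) k (b + c) j * u k
    rw [conv_apply, hsum]
    by_cases hj : j = k
    · subst hj; rw [Pi.single_eq_same, Pi.single_eq_same, smul_eq_mul, add_mul]
    · rw [Pi.single_eq_of_ne (Ne.symm hj), Pi.single_eq_of_ne hj, zero_mul]

end MatTuple

namespace MatTuple

variable {p : ℕ}

/-! ### Systems of Okubo normal form -/

/-- Up to a middle convolution, an Okubo system is `mc_c(X)` with `c` and `X` satisfying the
conditions of `Admissible.yokoyamaStep`. -/
theorem exists_mc_similar_toTuple [NeZero p] {S : OkuboSystem p} (h : S.toTuple.Admissible) :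
    ∃ (X : MatTuple p) (c : ℂ), c ≠ 0 ∧ X.Admissible ∧ 2 ≤ finrank ℂ X.V ∧
      (∀ v, (∑ i, X.op i v) + c • v = 0 → v = 0) ∧ (X.mc c).Similar S.toTuple ∧
      (S.toTuple.mc (-c)).Similar X := by
  obtain ⟨d, hd⟩ := ((Set.finite_singleton (0 : ℂ)).union
    (finite_not_injective S.A)).exists_notMem
  rw [Set.mem_union, not_or, Set.mem_singleton_iff, Set.mem_ofPred_eq, not_not] at hd
  have hsim := OkuboSystem.mc_toTuple h hd.2
  have hadm : (S.euler d).toTuple.Admissible := (h.mc d).of_similar hsim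
  have hA : ∀ v : (S.euler d).V, (S.euler d).A v + (-d) • v = S.A v := fun v => by
    change S.A v + d • (show S.V from v) + (-d) • (show S.V from v) = S.A v
    module
  have hinj : ∀ v : (S.euler d).V, (S.euler d).A v + (-d) • v = 0 → v = 0 := fun v hv =>
    OkuboSystem.A_injective_of_admissible h v ((hA v).symm.trans hv)
  -- `X` is the Euler transform `A + d` of the system and `c = -d`, so `∑ A_i + c` on `X` is the
  -- original matrix `A`, which is injective.
  refine ⟨(S.euler d).toTuple, -d, neg_ne_zero.mpr hd.1, hadm,
    OkuboSystem.two_le_finrank_of_admissible hadm, fun v hv => hinj v ?_,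
    (OkuboSystem.mc_toTuple hadm hinj).trans ?_, by rwa [neg_neg]⟩
  · refine Eq.trans (congrArg (· + (-d) • (v : (S.euler d).V)) ?_) hv
    exact ((S.euler d).sum_P _).symm
  · exact OkuboSystem.toTuple_similar (S := (S.euler d).euler (-d)) (T := S)
      (LinearMap.id (R := ℂ) (M := S.V)) Function.bijective_id (fun _ _ => rfl) hA

theorem Admissible.shiftedSwap_of_two_le {X : MatTuple p} (h : X.Admissible)
    (hd : 2 ≤ finrank ℂ X.V) (j : Fin p) (ν : ℂ) : (X.shiftedSwap j ν).Admissible :=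
  (h.irreducible.shiftedSwap j ν).admissible hd

/-- `C ∼ mc_c(X)` is reached at the single parameter `c`. A swap passes to generic parameters, a
second swap undoes the first and returns to `X`, and `mc_{-c}(C) ∼ X` transfers the result to `C`.
-/
theorem Admissible.genericallyReachable_self [NeZero p] {C : MatTuple p} (h : C.Admissible)
    (hC : C.IsONF) : GenericallyReachable C C := by
  obtain ⟨S, hS⟩ := hC
  obtain ⟨X, c, hc, hX, hd, hinj, hXS, hSX⟩ := exists_mc_similar_toTuple (h.of_similar hS)
  have h0 : YokoyamaReachable C (X.mc c) := ⟨C, .refl, hS.trans hXS.symm⟩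
  have h1 : GenericallyReachable C (X.shiftedSwap 0 0) :=
    hX.genericallyReachable_of_reachable 0 hc (by rwa [add_zero]) hinj h0
  have h2 := (h1.shiftedSwap (hX.shiftedSwap_of_two_le hd 0 0) 0 0).similar
    (shiftedSwap_shiftedSwap_similar X 0 0)
  exact (((h.of_similar hS).genericallyReachable_mc_iff (-c)).mp (h2.similar hSX.symm)).similar
    hS.symm

/-- Write `D ∼ mc_c(X)`. The swapped tuple is reachable at some generic `b`, and the step that swaps
back may end exactly at the prescribed `c`. -/
theorem GenericallyReachable.reachable [NeZero p] {C D : MatTuple p}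
    (hCD : GenericallyReachable C D) (h : D.Admissible) (hD : D.IsONF) :
    YokoyamaReachable C D := by
  obtain ⟨S, hS⟩ := hD
  obtain ⟨X, c, hc, hX, hd, hinj, hXS, hSX⟩ := exists_mc_similar_toTuple (h.of_similar hS)
  have h1 : GenericallyReachable C X :=
    (((h.of_similar hS).genericallyReachable_mc_iff (-c)).mpr (hCD.similar hS)).similar hSX
  have h2 := hX.shiftedSwap_of_two_le hd 0 0
  obtain ⟨b, hb, hb0, hbinj, hr⟩ := (h1.shiftedSwap hX 0 0).exists_parameter 0
  have hsim := shiftedSwap_shiftedSwap_similar X 0 0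
  have hstep := h2.yokoyamaStep 0 hb hb0 hbinj hc (by rwa [add_zero]) (fun v hv => hinj v (by
    rw [sum_shiftedSwap, shiftedSwap_same, zero_smul, zero_sub, zero_sub, neg_neg] at hv
    exact hv))
  exact (hr.step hstep).similar ((hsim.mc c).trans (hXS.trans hS.symm))

/-- With a single entry, an eigenvector would violate the kernel condition. -/
theorem Admissible.exists_ne {X : MatTuple p} (h : X.Admissible) (k : Fin p) : ∃ j, j ≠ k := by
  by_contra hn
  push Not at hn
  have := h.nontrivial
  obtain ⟨τ, hτ⟩ := End.exists_eigenvalue (X.op k)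
  obtain ⟨v, hv⟩ := hτ.exists_hasEigenvector
  exact hv.2 (h.ker k τ v (fun j hj => absurd (hn j) hj) hv.apply_eq_smul)

/-! ### Induction along Katz operations, including degenerate tuples. -/

/-- The invariant of all tuples obtained from `C`. -/
def Controlled (C X : MatTuple p) : Prop :=
  Subsingleton X.V ∨
  (finrank ℂ X.V = 1 ∧
    ∀ Y : MatTuple p, Y.Admissible → finrank ℂ Y.V = 1 → GenericallyReachable C Y) ∨
  (2 ≤ finrank ℂ X.V ∧ X.IsIrreducible ∧ GenericallyReachable C X)

theorem Controlled.similar {C X Y : MatTuple p} (h : Controlled C X) (hXY : X.Similar Y) :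
    Controlled C Y := by
  rcases h with h | ⟨h1, h⟩ | ⟨h1, h2, h3⟩
  · obtain ⟨g, _⟩ := hXY
    exact Or.inl g.symm.toEquiv.subsingleton
  · exact Or.inr (Or.inl ⟨hXY.finrank_eq ▸ h1, h⟩)
  · exact Or.inr (Or.inr ⟨hXY.finrank_eq ▸ h1, h2.of_similar hXY, h3.similar hXY⟩)

/-- The one-dimensional clause does not depend on the entries of `X`, so it survives a loss of
admissibility. -/
theorem Controlled.shiftedSwap [NeZero p] {C X : MatTuple p} (h : Controlled C X) (j : Fin p)
    (ν : ℂ) : Controlled C (X.shiftedSwap j ν) := by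
  rcases h with h | h | ⟨h1, h2, h3⟩
  · exact Or.inl h
  · exact Or.inr (Or.inl h)
  · exact Or.inr (Or.inr ⟨h1, h2.shiftedSwap j ν, h3.shiftedSwap (h2.admissible h1) j ν⟩)

theorem Admissible.controlled [NeZero p] {C X : MatTuple p} (hX : X.Admissible)
    (h : GenericallyReachable C X) : Controlled C X := by
  have := hX.nontrivial
  have hpos := finrank_pos (R := ℂ) (M := X.V)
  by_cases h1 : finrank ℂ X.V = 1
  · exact Or.inr (Or.inl ⟨h1, fun Y hY hY1 => h.of_finrank_eq_one hX h1 hY hY1⟩)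
  · exact Or.inr (Or.inr ⟨by omega, hX.irreducible, h⟩)

theorem Controlled.genericallyReachable {C X : MatTuple p} (h : Controlled C X)
    (hX : X.Admissible) : GenericallyReachable C X := by
  rcases h with h | ⟨h1, h⟩ | ⟨_, _, h⟩
  · have := hX.nontrivial
    exact absurd h (not_subsingleton_iff_nontrivial.mpr this)
  · exact h X hX h1
  · exact h

theorem exists_similar_single [NeZero p] {X : MatTuple p} (h : finrank ℂ X.V = 1)
    (hX : ¬ X.Admissible) : ∃ k b, X.Similar (scalar (Pi.single k b)) := by
  obtain ⟨a, ha⟩ := exists_similar_scalar h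
  obtain ⟨k, b, rfl⟩ := exists_single_of_not_admissible fun h => hX (h.of_similar ha.symm)
  exact ⟨k, b, ha⟩

theorem subsingleton_mc {X : MatTuple p} (h : Subsingleton X.V) (c : ℂ) :
    Subsingleton (X.mc c).V :=
  (Submodule.mkQ_surjective (X.convK ⊔ X.convL c)).subsingleton

/-- A controlled tuple that is not admissible is zero or one-dimensional with at most one nonzero
entry; its convolution then vanishes or is again of the latter kind. -/
theorem Controlled.mc [NeZero p] {C X : MatTuple p} (h : Controlled C X) (c : ℂ) :
    Controlled C (X.mc c) := by
  by_cases hX : X.Admissible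
  · exact (hX.mc c).controlled ((hX.genericallyReachable_mc_iff c).mpr (h.genericallyReachable hX))
  · rcases h with h | ⟨h1, h⟩ | ⟨h1, h2, _⟩
    · exact Or.inl (subsingleton_mc h c)
    · obtain ⟨k, b, hb⟩ := exists_similar_single h1 hX
      refine Controlled.similar ?_ (hb.mc c).symm
      by_cases hbc : b = 0 ∨ b + c = 0
      · exact Or.inl (subsingleton_mc_scalar hbc)
      · push Not at hbc
        exact Controlled.similar (Or.inr (Or.inl ⟨finrank_self ℂ, h⟩))
          (mc_scalar_similar hbc.1 hbc.2).symm
    · exact absurd (h2.admissible h1) hX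

theorem Controlled.of_katzReachable [NeZero p] {C X Y : MatTuple p} (h : Controlled C X)
    (hXY : KatzReachable X Y) : Controlled C Y := by
  have hs : ∀ X Y : MatTuple p, X.Similar Y → Controlled C X → Controlled C Y :=
    fun X Y hXY h => h.similar hXY
  have hq : ∀ (X : MatTuple p) j ν, Controlled C X → Controlled C (X.shiftedSwap j ν) :=
    fun X j ν h => h.shiftedSwap j ν
  induction hXY with
  | refl => exact h
  | tail _ hstep ih =>
    cases hstep with
    | addition μ => exact addition_of_shiftedSwap hs hq _ μ ih
    | mc c => exact ih.mc c
    | inftySwap j hj => exact (ih.shiftedSwap j 0).similar (inftySwap_similar _ j)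
    | perm σ => exact perm_of_shiftedSwap hs hq σ _ ih
    | similar _ hXY => exact ih.similar hXY

theorem subsingleton_of_katzReachable {X Y : MatTuple p} (h : Subsingleton X.V)
    (hXY : KatzReachable X Y) : Subsingleton Y.V := by
  induction hXY with
  | refl => exact h
  | tail _ hstep ih =>
    cases hstep with
    | addition μ => exact ih
    | mc c => exact subsingleton_mc ih c
    | inftySwap j hj => exact ih
    | perm σ => exact ih
    | similar _ hXY =>
      obtain ⟨g, _⟩ := hXY
      exact g.symm.toEquiv.subsingleton

/-- The one-dimensional Okubo systems with nonzero residue are reachable. -/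
theorem reachable_scalar_single [NeZero p] {C : MatTuple p} {j k : Fin p} (hjk : j ≠ k) {c : ℂ}
    (hc : c ≠ 0) (h : ∀ Y : MatTuple p, Y.Admissible → finrank ℂ Y.V = 1 →
      GenericallyReachable C Y) : YokoyamaReachable C (scalar (Pi.single k c)) := by
  -- Start from the admissible tuple with `c - d` at `k` and `e` at `j`. A step with `ν = c - d + e`
  -- clears the entry at `j` and ends with `mc_d`, which turns `c - d` into `c`. The excluded values
  -- ensure that `d`, `c - d`, `e` and `d + ν = c + e` are nonzero.
  obtain ⟨d, hd⟩ := (Set.toFinite {0, c}).exists_notMem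
  obtain ⟨e, he⟩ := (Set.toFinite {0, -c}).exists_notMem
  simp only [Set.mem_insert_iff, Set.mem_singleton_iff, not_or] at hd he
  have hcd : c - d ≠ 0 := sub_ne_zero.mpr (Ne.symm hd.2)
  set a : Fin p → ℂ := Function.update (Pi.single k (c - d)) j e with ha
  have haj : a j = e := Function.update_self _ _ _
  have hak : a k = c - d := by rw [ha, Function.update_of_ne hjk.symm, Pi.single_eq_same]
  have hadm : (scalar a).Admissible :=
    scalar_admissible hjk (by rw [haj]; exact he.1) (by rw [hak]; exact hcd)
  have hsum : ∑ i, a i = c - d + e := by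
    rw [Fintype.sum_eq_add k j hjk.symm, hak, haj]
    intro i hi
    rw [ha, Function.update_of_ne hi.2, Pi.single_eq_of_ne hi.1]
  have hupd : Function.update a j 0 = Pi.single k (c - d) := by
    funext i
    by_cases hi : i = j
    · subst hi; rw [Function.update_self, Pi.single_eq_of_ne hjk]
    · rw [Function.update_of_ne hi, ha, Function.update_of_ne hi]
  have hsim : ((scalar a).shiftedSwap j (c - d + e)).Similar (scalar (Pi.single k (c - d))) := by
    have := scalar_shiftedSwap a j 0
    rwa [hsum, hupd, zero_add] at this
  obtain ⟨b, hb, hbν, hbinj, hr⟩ := (h (scalar a) hadm (finrank_self ℂ)).exists_parameter (c - d + e)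
  have hstep := hadm.yokoyamaStep j hb hbν hbinj (d := d) hd.1
    (fun h0 => he.2 (by linear_combination h0)) (fun (v : ℂ) hv => by
      rw [sum_shiftedSwap, scalar_op, haj, smul_eq_mul, smul_eq_mul] at hv
      have : c * v = 0 := by linear_combination hv
      exact (mul_eq_zero.mp this).resolve_left hc)
  have hfin := mc_scalar_similar (p := p) (k := k) (b := c - d) (c := d) hcd
    (by rwa [sub_add_cancel])
  rw [sub_add_cancel] at hfin
  exact (hr.step hstep).similar ((hsim.mc d).trans hfin)

theorem reachable_of_controlled [NeZero p] {C B : MatTuple p} (hC : C.Admissible)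
    (hB : Controlled C B) (c : ℂ) (hONF : (B.mc c).IsONF) (hpos : 0 < finrank ℂ (B.mc c).V) :
    YokoyamaReachable C (B.mc c) := by
  by_cases hBadm : B.Admissible
  · exact ((hB.mc c).genericallyReachable (hBadm.mc c)).reachable (hBadm.mc c) hONF
  · rcases hB with h | ⟨h1, h⟩ | ⟨h1, h2, _⟩
    · have := subsingleton_mc h c
      exact absurd finrank_zero_of_subsingleton hpos.ne'
    · obtain ⟨k, b, hb⟩ := exists_similar_single h1 hBadm
      by_cases hbc : b = 0 ∨ b + c = 0
      · have := subsingleton_mc_scalar (k := k) hbc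
        rw [(hb.mc c).finrank_eq, finrank_zero_of_subsingleton] at hpos
        exact absurd hpos (lt_irrefl 0)
      · push Not at hbc
        obtain ⟨j, hj⟩ := hC.exists_ne k
        exact (reachable_scalar_single hj hbc.2 h).similar
          ((hb.mc c).trans (mc_scalar_similar hbc.1 hbc.2)).symm
    · exact absurd (h2.admissible h1) hBadm

theorem similar_of_subsingleton {X Y : MatTuple p} (hX : Subsingleton X.V)
    (hY : Subsingleton Y.V) : X.Similar Y :=
  Similar.of_bijective 0 ⟨fun _ _ _ => Subsingleton.elim _ _,
    fun _ => ⟨0, Subsingleton.elim _ _⟩⟩ fun _ _ => Subsingleton.elim _ _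

/-- For `n = 1` two nonzero entries give admissibility. For `n ≥ 2` it follows from irreducibility,
and `p = 0` is impossible since every line would be invariant. -/
theorem ofMatrices_admissible {n : ℕ} {A : Fin p → Matrix (Fin n) (Fin n) ℂ} (hn : n ≠ 0)
    (hA : (ofMatrices A).IsIrreducible)
    (hA₁ : n = 1 → ∃ i j : Fin p, i ≠ j ∧ A i ≠ 0 ∧ A j ≠ 0) :
    p ≠ 0 ∧ (ofMatrices A).Admissible := by
  have hfin : finrank ℂ (ofMatrices A).V = n := finrank_fin_fun ℂ
  by_cases h1 : n = 1
  · obtain ⟨i, j, hij, hi, hj⟩ := hA₁ h1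
    obtain ⟨a, ha⟩ := exists_similar_scalar (hfin.trans h1)
    have key : ∀ k, A k ≠ 0 → a k ≠ 0 := fun k hk ha0 => by
      obtain ⟨g, hg⟩ := ha
      apply hk
      rw [← (Matrix.toLin' (R := ℂ)).map_eq_zero_iff]
      refine LinearMap.ext fun v => g.injective ((hg k v).trans ?_)
      rw [scalar_op, ha0, zero_mul]
      exact (map_zero g).symm
    exact ⟨fun hp => (hp ▸ i).elim0, (scalar_admissible hij (key i hi) (key j hj)).of_similar ha.symm⟩
  · refine ⟨fun hp => ?_, hA.admissible (by omega)⟩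
    subst hp
    have : Nontrivial (ofMatrices A).V := nontrivial_of_finrank_pos (R := ℂ) (by omega)
    obtain ⟨v, hv⟩ := _root_.exists_ne (0 : (ofMatrices A).V)
    rcases hA (Submodule.span ℂ {v}) fun j => j.elim0 with h | h
    · exact hv (Submodule.span_singleton_eq_bot.mp h)
    · have := finrank_span_singleton (K := ℂ) hv
      rw [h, finrank_top] at this
      omega

end MatTuple

/-! ### Conclusion. -/

theorem mainTheorem1 {p n n' : ℕ}
    (A : Fin p → Matrix (Fin n) (Fin n) ℂ) (B : Fin p → Matrix (Fin n') (Fin n') ℂ)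
    (hA : (MatTuple.ofMatrices A).IsIrreducible)
    (hA₁ : n = 1 → ∃ i j : Fin p, i ≠ j ∧ A i ≠ 0 ∧ A j ≠ 0)
    (hAB : MatTuple.KatzReachable (MatTuple.ofMatrices A) (MatTuple.ofMatrices B)) :
    {α : ℂ | ¬ ((MatTuple.ofMatrices A).mc α).IsONF}.Finite ∧
    {β : ℂ | ¬ ((MatTuple.ofMatrices B).mc β).IsONF}.Finite ∧
    ((MatTuple.ofMatrices A).IsONF →
      ((MatTuple.ofMatrices A).mc 0).IsONF ∧
      ((MatTuple.ofMatrices A).mc 0).Similar (MatTuple.ofMatrices A)) ∧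
    ∀ α β : ℂ, ((MatTuple.ofMatrices A).mc α).IsONF → ((MatTuple.ofMatrices B).mc β).IsONF →
      0 < Module.finrank ℂ ((MatTuple.ofMatrices B).mc β).V →
      MatTuple.YokoyamaReachable ((MatTuple.ofMatrices A).mc α) ((MatTuple.ofMatrices B).mc β) := by
  refine ⟨MatTuple.finite_not_isONF _, MatTuple.finite_not_isONF _, ?_⟩
  by_cases hn : n = 0
  · have hsub : Subsingleton (MatTuple.ofMatrices A).V := by
      subst hn
      exact inferInstanceAs (Subsingleton (Fin 0 → ℂ))
    refine ⟨fun hONF => ?_, fun α β _ _ hpos => ?_⟩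
    · have := MatTuple.similar_of_subsingleton (MatTuple.subsingleton_mc hsub 0) hsub
      exact ⟨this.symm.isONF hONF, this⟩
    · have := MatTuple.subsingleton_mc (MatTuple.subsingleton_of_katzReachable hsub hAB) β
      exact absurd finrank_zero_of_subsingleton hpos.ne'
  · obtain ⟨hp, hadm⟩ := MatTuple.ofMatrices_admissible hn hA hA₁
    have : NeZero p := ⟨hp⟩
    refine ⟨fun hONF => ⟨hadm.mc_zero.symm.isONF hONF, hadm.mc_zero⟩, fun α β hα hβ hpos => ?_⟩
    have hC := hadm.mc α
    -- Generic reachability of `mc_α(A)` from itself descends to `A`, the starting point of the Katz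
    -- operations.
    have hgen := (hadm.genericallyReachable_mc_iff α).mp (hC.genericallyReachable_self hα)
    exact MatTuple.reachable_of_controlled hC ((hadm.controlled hgen).of_katzReachable hAB) β hβ hpos
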